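/- Let $K$ be a field and $\Delta$ a simplicial complex on a finite vertex set which is the disjoint union of $V=\{v_1,\dots,v_m\}$ and $W=\{w_1,\dots,w_n\}$. Let $K[\Delta]=K[X_1,\dots,X_m,Y_1,\dots,Y_n]/I_\Delta$ be its Stanley–Reisner ring, where $X_i$ corresponds to $v_i$ and $Y_j$ to $w_j$, let $x_i,y_j$ be the residue classes of the variables, and let $P=(y_1,\dots,y_n)\subset K[\Delta]$. Give $K[\Delta]$ the $\mathbb Z\times\mathbb Z$-bigrading with $\deg x_i=(1,0)$ and $\deg y_j=(0,1)$, and give the local cohomology $H^i_P(K[\Delta])$, computed as the cohomology of the Čech complex $C^t=\bigoplus_{j_1<\dots<j_t}K[\Delta]_{y_{j_1}\cdots y_{j_t}}$, the induced bigrading. Then for all $i$ and all $k,j\in\mathbb Z$ the component $H^i_P(K[\Delta])_{(k,j)}$ is a finite-dimensional $K$-vector space and $$\dim_K H^i_P(K[\Delta])_{(k,j)}=\sum_{F\in\Delta_W}\ \sum_{G\subseteq V} d(i,F,G)\binom{k-1}{|G|-1}\binom{-j-1}{|F|-1},$$ where $$d(i,F,G)=\dim_K\widetilde H_{i-|F|-1}\bigl((\operatorname{lk}_\Delta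 (F\cup G))_W;K\bigr).$$ Here $\Gamma_W$ is the subcomplex of all faces of $\Gamma$ contained in $W$; $\operatorname{lk}_\Delta A=\{T: T\cup A\in\Delta,\ T\cap A=\emptyset\}$, which is the void complex, with zero homology, if $A\notin\Delta$; $\widetilde H$ is reduced simplicial homology, so that $\widetilde H_{-1}(\{\emptyset\};K)=K$; the faces $F$ and the sets $G$ may be empty; and for integers $a$ and $b\ge -1$ the binomial coefficient $\binom ab$ is the usual one if $0\le b\le a$, $\binom{-1}{-1}=1$, $\binom{a}{-1}=0$ for $a\ge 0$, and $\binom ab=0$ whenever $a<b$. -/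

import Mathlib

/-! ### Simplicial complexes

A simplicial complex on the vertex set `σ` is a family of finite subsets of `σ` closed under
passing to subsets, that is, a `LowerSet (Finset σ)`.  The empty set is a face as soon as there is
any face; the void complex `⊥` has no face at all, while `{∅}` has exactly one. -/

namespace StanleyReisner

open scoped Classical in
/-- The finite set of all faces of a simplicial complex on a finite vertex set. -/
noncomputable def faces {σ : Type*} [Fintype σ] (Γ : LowerSet (Finset σ)) : Finset (Finset σ) :=
  Finset.univ.filter (fun T => T ∈ Γ)

/-- The link `lk_Γ A = {T : T ∪ A ∈ Γ, T ∩ A = ∅}`. It is void when `A` is not a face. -/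
def link {σ : Type*} [DecidableEq σ] (Γ : LowerSet (Finset σ)) (A : Finset σ) :
    LowerSet (Finset σ) where
  carrier := {T | T ∪ A ∈ Γ ∧ Disjoint T A}
  lower' := fun _ _ hle h =>
    ⟨Γ.lower (Finset.union_subset_union hle subset_rfl) h.1, Finset.disjoint_of_subset_left hle h.2⟩

/-- The restriction `Γ_W`: all faces of `Γ` whose vertices belong to `W`. -/
def restrict {σ : Type*} (Γ : LowerSet (Finset σ)) (W : Finset σ) : LowerSet (Finset σ) where
  carrier := {T | T ∈ Γ ∧ T ⊆ W}
  lower' := fun _ _ hle h => ⟨Γ.lower hle h.1, hle.trans h.2⟩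

/-- The homology module `Z / B` of cycles modulo boundaries. -/
abbrev Homology {R M : Type*} [CommRing R] [AddCommGroup M] [Module R M] (Z B : Submodule R M) :
    Type _ :=
  Z ⧸ B.submoduleOf Z

/-! ### Reduced simplicial homology -/

section ReducedHomology

universe u v

variable (K : Type u) [Field K] {σ : Type v} [LinearOrder σ]

/-- The oriented boundary map of the full simplex on `σ`, with the empty simplex in degree `-1`:
`∂ e_T = ∑_{v ∈ T} (-1)^{#{u ∈ T : u < v}} e_{T \ {v}}`. -/
noncomputable def boundary : (Finset σ →₀ K) →ₗ[K] (Finset σ →₀ K) :=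
  Finsupp.linearCombination K (fun T : Finset σ =>
    ∑ v ∈ T, Finsupp.single (T.erase v) ((-1 : K) ^ (T.filter (fun u => u < v)).card))

/-- The `q`-chains of the augmented oriented chain complex of `Γ`: the span of the `e_T`
with `T` a face having `q + 1` vertices. -/
noncomputable def chains (Γ : LowerSet (Finset σ)) (q : ℤ) : Submodule K (Finset σ →₀ K) :=
  Finsupp.supported K K {T | T ∈ Γ ∧ (T.card : ℤ) = q + 1}

/-- Reduced `q`-cycles. -/
noncomputable def cycles (Γ : LowerSet (Finset σ)) (q : ℤ) : Submodule K (Finset σ →₀ K) :=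
  chains K Γ q ⊓ LinearMap.ker (boundary K)

/-- Reduced `q`-boundaries. -/
noncomputable def boundaries (Γ : LowerSet (Finset σ)) (q : ℤ) : Submodule K (Finset σ →₀ K) :=
  (chains K Γ (q + 1)).map (boundary K)

/-- The reduced simplicial homology `H̃_q(Γ; K)`. -/
abbrev ReducedHomology (Γ : LowerSet (Finset σ)) (q : ℤ) : Type (max u v) :=
  Homology (cycles K Γ q) (boundaries K Γ q)

/-- `d(i, F, G) = dim_K H̃_{i-|F|-1}((lk (F ∪ G))_W; K)`. -/
noncomputable def linkDim (Δ : LowerSet (Finset σ)) (W : Finset σ) (i : ℤ) (F G : Finset σ) : ℕ :=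
  Module.finrank K (ReducedHomology K (restrict (link Δ (F ∪ G)) W) (i - F.card - 1))

end ReducedHomology

/-! ### Local cohomology through the Čech complex -/

section Cech

variable {R : Type*} [CommRing R] {ι : Type*} [LinearOrder ι] [Fintype ι] (y : ι → R)

/-- `R_{y_F}` where `y_F = ∏_{w ∈ F} y_w`. -/
abbrev CechTerm (F : Finset ι) : Type _ := Localization.Away (∏ w ∈ F, y w)

theorem isUnit_cechTerm {R : Type*} [CommRing R] {ι : Type*} (y : ι → R) {F F' : Finset ι} (h : F ⊆ F')
    (a : Submonoid.powers (∏ w ∈ F, y w)) : IsUnit (Algebra.ofId R (CechTerm y F') (a : R)) := by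
  obtain ⟨_, l, rfl⟩ := a
  have h1 : IsUnit (algebraMap R (CechTerm y F') (∏ w ∈ F', y w)) :=
    IsLocalization.Away.algebraMap_isUnit _
  have h2 : (∏ w ∈ F, y w) ∣ ∏ w ∈ F', y w := Finset.prod_dvd_prod_of_subset _ _ _ h
  simpa only [Algebra.ofId_apply, map_pow] using
    (isUnit_of_dvd_unit (map_dvd (algebraMap R (CechTerm y F')) h2) h1).pow l

/-- The natural map `R_{y_F} → R_{y_{F'}}` for `F ⊆ F'`. -/
noncomputable def cechRestriction {F F' : Finset ι} (h : F ⊆ F') :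
    CechTerm y F →ₐ[R] CechTerm y F' :=
  IsLocalization.liftAlgHom (M := Submonoid.powers (∏ w ∈ F, y w))
    (f := Algebra.ofId R (CechTerm y F')) (isUnit_cechTerm y h)

/-- The direct sum `⨁_F R_{y_F}` of all terms of the Čech complex, over all (finitely many)
subsets `F` of the index set. -/
abbrev CechTotal : Type _ := (F : Finset ι) → CechTerm y F

/-- The Čech differential: the component at `F'` of `d c` is
`∑_{w ∈ F'} (-1)^{#{u ∈ F' : u < w}} c_{F' \ {w}}`. -/
noncomputable def cechDifferential : CechTotal y →ₗ[R] CechTotal y :=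
  LinearMap.pi (fun F' => ∑ w ∈ F', ((-1 : R) ^ (F'.filter (fun u => u < w)).card) •
    ((cechRestriction y (F'.erase_subset w)).toLinearMap.comp (LinearMap.proj (F'.erase w))))

/-- `C^t = ⨁_{|F| = t} R_{y_F}`, as a submodule of the total direct sum. -/
def cechCochains (t : ℤ) : Submodule R (CechTotal y) where
  carrier := {c | ∀ F : Finset ι, (F.card : ℤ) ≠ t → c F = 0}
  add_mem' := fun ha hb F hF => by simp [ha F hF, hb F hF]
  zero_mem' := fun _ _ => rfl
  smul_mem' := fun r c hc F hF => by simp [hc F hF]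

/-- Čech `t`-cocycles. -/
noncomputable def cechCocycles (t : ℤ) : Submodule R (CechTotal y) :=
  cechCochains y t ⊓ LinearMap.ker (cechDifferential y)

/-- Čech `t`-coboundaries. -/
noncomputable def cechCoboundaries (t : ℤ) : Submodule R (CechTotal y) :=
  (cechCochains y (t - 1)).map (cechDifferential y)

/-- The local cohomology module `H^t_P(R)` of `R` with respect to the ideal `P` generated by the
`y_w`, as the cohomology of the Čech complex of `R` on the `y_w`. -/
abbrev LocalCohomology (t : ℤ) : Type _ :=
  Homology (cechCocycles y t) (cechCoboundaries y t)

end Cech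

/-! ### The bigraded Stanley–Reisner ring and its local cohomology -/

section Ring

variable (K : Type*) [Field K] {σ : Type*}

/-- The Stanley–Reisner ideal, generated by the monomials `∏_{v ∈ T} X_v` with `T ∉ Δ`. -/
noncomputable def stanleyReisnerIdeal (Δ : LowerSet (Finset σ)) : Ideal (MvPolynomial σ K) :=
  Ideal.span {f | ∃ T : Finset σ, T ∉ Δ ∧ f = ∏ v ∈ T, MvPolynomial.X v}

/-- The Stanley–Reisner ring `K[Δ]`. -/
abbrev StanleyReisnerRing (Δ : LowerSet (Finset σ)) : Type _ :=
  MvPolynomial σ K ⧸ stanleyReisnerIdeal K Δ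

/-- The residue classes `y_w` of the variables belonging to `W`. -/
noncomputable def yVar (Δ : LowerSet (Finset σ)) (W : Finset σ) (w : W) : StanleyReisnerRing K Δ :=
  Ideal.Quotient.mk (stanleyReisnerIdeal K Δ) (MvPolynomial.X (w : σ))

variable [LinearOrder σ]

/-- The bidegree of a variable: `(0, 1)` for vertices in `W`, and `(1, 0)` for the others. -/
def bidegree (W : Finset σ) (v : σ) : ℤ × ℤ := if v ∈ W then (0, 1) else (1, 0)

/-- The bihomogeneous component `K[Δ]_d`, for `d ∈ ℤ × ℤ`. -/
noncomputable def ringComponent (Δ : LowerSet (Finset σ)) (W : Finset σ) (d : ℤ × ℤ) :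
    Submodule K (StanleyReisnerRing K Δ) :=
  (MvPolynomial.weightedHomogeneousSubmodule K (bidegree W) d).map
    (Ideal.Quotient.mkₐ K (stanleyReisnerIdeal K Δ)).toLinearMap

/-- The component `(R_y)_d = {r / y^l : r ∈ R bihomogeneous, deg r - l deg y = d}` of `R = K[Δ]`
localized at `y = y_F`, `F ⊆ W`. -/
noncomputable def cechTermComponent (Δ : LowerSet (Finset σ)) (W : Finset σ) (d : ℤ × ℤ)
    (F : Finset W) : Submodule K (CechTerm (yVar K Δ W) F) :=
  Submodule.span K {z | ∃ (l : ℕ) (r : StanleyReisnerRing K Δ),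
    r ∈ ringComponent K Δ W (d + l • ∑ w ∈ F, bidegree W (w : σ)) ∧
    z = Localization.mk r (⟨(∏ w ∈ F, yVar K Δ W w) ^ l, ⟨l, rfl⟩⟩ :
      Submonoid.powers (∏ w ∈ F, yVar K Δ W w))}

/-- `H^i_P(K[Δ])` for the ideal `P = (y_w : w ∈ W)`. -/
abbrev SRLocalCohomology (Δ : LowerSet (Finset σ)) (W : Finset σ) (i : ℤ) : Type _ :=
  LocalCohomology (yVar K Δ W) i

/-- The bigraded component `H^i_P(K[Δ])_d`: the classes of the Čech `i`-cocycles all of whose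
entries are bihomogeneous of bidegree `d`. -/
noncomputable def localCohomologyComponent (Δ : LowerSet (Finset σ)) (W : Finset σ) (i : ℤ)
    (d : ℤ × ℤ) : Submodule K (SRLocalCohomology K Δ W i) :=
  Submodule.map
    (((cechCoboundaries (yVar K Δ W) i).submoduleOf (cechCocycles (yVar K Δ W) i)).mkQ.restrictScalars K)
    (Submodule.comap ((cechCocycles (yVar K Δ W) i).subtype.restrictScalars K)
      (Submodule.pi Set.univ (cechTermComponent K Δ W d)))

end Ring

/-- The binomial coefficient `C(a, b)` for integers `a` and `b ≥ -1`: the usual one for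
`0 ≤ b ≤ a`, with the conventions `C(-1, -1) = 1`, `C(a, -1) = 0` for `a ≥ 0`, and
`C(a, b) = 0` whenever `a < b`. Thus `C(k - 1, g - 1)` is the number of ways to write `k` as an
ordered sum of `g` positive integers. -/
def binom (a b : ℤ) : ℕ :=
  if a = -1 ∧ b = -1 then 1 else if 0 ≤ a ∧ 0 ≤ b then a.toNat.choose b.toNat else 0

end StanleyReisner

/-!
The Čech complex of `K[Δ]` on the variables of `W` is graded by `ℤ^σ`, which refines the bigrading.
For `U ⊆ W` the localization `R_{y_U}` has as a `K`-basis the Laurent monomials whose exponent `a`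
is nonnegative off `U` and satisfies `U ∪ supp a ∈ Δ` (`exists_eq_linearCombination`). They are
linearly independent because `R_{y_U}` maps to the Laurent polynomial ring by killing the variables
outside the face `U ∪ supp a`. The restriction maps send Laurent monomials to Laurent monomials or
to zero (`coefficient_cechRestriction`), so that the Čech complex is the direct sum over `a` of the
simplicial cochain complexes on the families `exponentSets Δ W a` of subsets of `W`
(`mem_cechCocycles_iff`, `mem_cechCoboundaries_iff`).

Let `F` and `G` be the sets where `a` is negative and positive. If `F ⊈ W`, the family is empty. If
`G` contains some `w ∈ W`, the family is a cone with apex `w` and its complex is contractible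
(`IsCochain.exists_coboundary_of_cone`). In the remaining case the family consists of the sets
`T ∪ F` with `T` a face of the link of `F ∪ G` in `W`, and up to signs and a shift by `|F|` the
complex is the dual of the augmented chain complex of that link. Over a field, cocycles modulo
coboundaries are then the dual of cycles modulo boundaries (`exists_cocycle_joinPairing_eq`,
`exists_coboundary_of_joinPairing_eq_zero`), so the exponent `a` contributes `d(i, F, G)`.

A bigraded component therefore has dimension `∑ d(i, F, G)` over the finitely many exponents `a` of
the given bidegree that are nonpositive on `W` and nonnegative off `W`
(`finrank_localCohomologyComponent`). For fixed `F` and `G` these exponents are pairs of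
compositions of `k` into `|G|` and of `-j` into `|F|` positive parts, which are counted by the two
binomial coefficients (`card_filter_essentialExponents`).
-/

namespace StanleyReisner

/-! ### Simplicial chains and cochains -/

section Combinatorics

variable (K : Type*) [Field K] {σ : Type*}

/-- A functional on a subspace `C` which vanishes on the kernel of `f` factors through `f`. -/
theorem exists_dual_apply_eq {K : Type*} [Field K] {V V' : Type*} [AddCommGroup V] [Module K V]
    [AddCommGroup V'] [Module K V'] (f : V →ₗ[K] V') (φ : Module.Dual K V) {C : Submodule K V}
    (h : ∀ x ∈ C, f x = 0 → φ x = 0) : ∃ g : Module.Dual K V', ∀ x ∈ C, g (f x) = φ x := by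
  have hmem : φ.comp C.subtype ∈ LinearMap.range (f.comp C.subtype).dualMap := by
    rw [LinearMap.range_dualMap_eq_dualAnnihilator_ker, Submodule.mem_dualAnnihilator]
    exact fun x hx => h x.1 x.2 hx
  obtain ⟨g, hg⟩ := hmem
  exact ⟨g, fun x hx => LinearMap.congr_fun hg ⟨x, hx⟩⟩

theorem single_mem_chains {Γ : LowerSet (Finset σ)} {q : ℤ} {T : Finset σ} (hT : T ∈ Γ)
    (hq : (T.card : ℤ) = q + 1) : Finsupp.single T (1 : K) ∈ chains K Γ q :=
  Finsupp.single_mem_supported K 1 ⟨hT, hq⟩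

/-- Two linear maps agree on the `q`-chains once they agree on the `q`-faces. -/
theorem linearMap_eq_of_mem_chains {M : Type*} [AddCommGroup M] [Module K M]
    {Γ : LowerSet (Finset σ)} {q : ℤ} {f g : (Finset σ →₀ K) →ₗ[K] M}
    (h : ∀ T ∈ Γ, (T.card : ℤ) = q + 1 → f (Finsupp.single T 1) = g (Finsupp.single T 1))
    {x : Finset σ →₀ K} (hx : x ∈ chains K Γ q) : f x = g x := by
  rw [chains, Finsupp.supported_eq_span_single] at hx
  have := LinearMap.eqOn_span (f := f) (g := g) (s := (fun i => Finsupp.single i (1 : K)) ''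
    {T | T ∈ Γ ∧ (T.card : ℤ) = q + 1}) ?_ hx
  · exact this
  · rintro _ ⟨T, ⟨h1, h2⟩, rfl⟩
    exact h T h1 h2

variable [LinearOrder σ]

/-- The incidence sign `(-1)^{#{u ∈ S : u < v}}` of the pair `S \ {v} ⊂ S`. -/
def faceSign (S : Finset σ) (v : σ) : K := (-1) ^ (S.filter (fun u => u < v)).card

theorem faceSign_mul_self (S : Finset σ) (v : σ) : faceSign K S v * faceSign K S v = 1 := by
  rw [faceSign, ← mul_pow]; simp

theorem faceSign_erase {S : Finset σ} {v : σ} (hv : v ∈ S) (u : σ) :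
    faceSign K (S.erase v) u = if v < u then -faceSign K S u else faceSign K S u := by
  unfold faceSign
  rw [Finset.filter_erase]
  split_ifs with h
  · have hm : v ∈ S.filter (fun x => x < u) := by simp [hv, h]
    rw [← Finset.card_erase_add_one hm, pow_succ]; ring
  · rw [Finset.erase_eq_of_notMem (by simp [h])]

/-- Removing two vertices in the two possible orders produces opposite signs. -/
theorem faceSign_mul_faceSign_erase {S : Finset σ} {u v : σ} (hu : u ∈ S) (hv : v ∈ S)
    (huv : u ≠ v) :
    faceSign K S v * faceSign K (S.erase v) u = -(faceSign K S u * faceSign K (S.erase u) v) := by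
  rw [faceSign_erase K hv, faceSign_erase K hu]
  rcases lt_or_gt_of_ne huv with h | h
  · rw [if_neg h.not_gt, if_pos h]; ring
  · rw [if_pos h, if_neg h.not_gt]; ring

theorem boundary_single (S : Finset σ) :
    boundary K (Finsupp.single S 1) =
      ∑ v ∈ S, faceSign K S v • Finsupp.single (S.erase v) (1 : K) := by
  simp [boundary, faceSign]

theorem boundary_boundary (x : Finset σ →₀ K) : boundary K (boundary K x) = 0 := by
  suffices h : (boundary K (σ := σ)).comp (boundary K) = 0 from LinearMap.congr_fun h x
  refine Finsupp.lhom_ext' fun S => LinearMap.ext_ring ?_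
  simp only [LinearMap.comp_apply, Finsupp.lsingle_apply, LinearMap.zero_apply]
  rw [boundary_single, map_sum]
  simp only [map_smul, boundary_single, Finset.smul_sum, smul_smul]
  rw [Finset.sum_sigma']
  refine Finset.sum_involution (fun p _ => ⟨p.2, p.1⟩) ?_ ?_ ?_ ?_
  · rintro ⟨v, u⟩ h
    simp only [Finset.mem_sigma, Finset.mem_erase] at h
    rw [faceSign_mul_faceSign_erase K h.2.2 h.1 h.2.1, Finset.erase_right_comm, neg_smul,
      neg_add_cancel]
  · rintro ⟨v, u⟩ h _ h'
    simp only [Finset.mem_sigma, Finset.mem_erase] at h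
    exact h.2.1 (congrArg Sigma.fst h')
  · rintro ⟨v, u⟩ h
    simp only [Finset.mem_sigma, Finset.mem_erase] at h ⊢
    exact ⟨h.2.2, h.2.1.symm, h.1⟩
  · rintro ⟨v, u⟩ h
    rfl

theorem boundary_mem_chains {Γ : LowerSet (Finset σ)} {q : ℤ} {x : Finset σ →₀ K}
    (hx : x ∈ chains K Γ (q + 1)) : boundary K x ∈ chains K Γ q := by
  suffices h : chains K Γ (q + 1) ≤ (chains K Γ q).comap (boundary K) from h hx
  conv_lhs => rw [chains, Finsupp.supported_eq_span_single]
  rw [Submodule.span_le]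
  rintro _ ⟨T, ⟨hT, hc⟩, rfl⟩
  simp only [Submodule.comap_coe, Set.mem_preimage, SetLike.mem_coe, boundary_single]
  refine Submodule.sum_mem _ fun v hv => Submodule.smul_mem _ _ (single_mem_chains K ?_ ?_)
  · exact Γ.lower (Finset.erase_subset v T) hT
  · rw [Finset.cast_card_erase_of_mem hv, hc]; ring

theorem boundaries_le_cycles (Γ : LowerSet (Finset σ)) (q : ℤ) :
    boundaries K Γ q ≤ cycles K Γ q := by
  rintro _ ⟨x, hx, rfl⟩
  exact ⟨boundary_mem_chains K hx, boundary_boundary K x⟩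

/-- The simplicial coboundary of a function on the subsets of `σ`. -/
def coboundary : (Finset σ → K) →ₗ[K] (Finset σ → K) where
  toFun c S := ∑ v ∈ S, faceSign K S v * c (S.erase v)
  map_add' c c' := by ext S; simp [mul_add, Finset.sum_add_distrib]
  map_smul' r c := by ext S; simp [Finset.mul_sum, mul_left_comm]

theorem coboundary_apply (c : Finset σ → K) (S : Finset σ) :
    coboundary K c S = ∑ v ∈ S, faceSign K S v * c (S.erase v) := rfl

variable {K}

/-- The function `c` is supported on the members of `𝒜` with `t` elements. -/
def IsCochain (𝒜 : Set (Finset σ)) (t : ℤ) (c : Finset σ → K) : Prop :=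
  ∀ S, c S ≠ 0 → S ∈ 𝒜 ∧ (S.card : ℤ) = t

theorem IsCochain.coboundary_eq_zero {𝒜 : Set (Finset σ)} {t : ℤ} {c : Finset σ → K}
    (hc : IsCochain 𝒜 t c) {S : Finset σ} (hS : (S.card : ℤ) ≠ t + 1) : coboundary K c S = 0 := by
  rw [coboundary_apply]
  refine Finset.sum_eq_zero fun v hv => ?_
  by_contra h
  refine hS ?_
  rw [← (hc _ (right_ne_zero_of_mul h)).2, Finset.cast_card_erase_of_mem hv]; ring

/-- If `𝒜` is a cone with apex `w`, that is, if membership in `𝒜` does not depend on `w`, then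
its cochain complex is contractible. -/
theorem IsCochain.exists_coboundary_of_cone {𝒜 : Set (Finset σ)} {w : σ}
    (hw : ∀ S, insert w S ∈ 𝒜 ↔ S ∈ 𝒜) {t : ℤ} {c : Finset σ → K} (hc : IsCochain 𝒜 t c)
    (hz : ∀ S ∈ 𝒜, coboundary K c S = 0) :
    ∃ b, IsCochain 𝒜 (t - 1) b ∧ ∀ S ∈ 𝒜, coboundary K b S = c S := by
  -- the contracting homotopy
  refine ⟨fun S => if w ∈ S then 0 else faceSign K (insert w S) w * c (insert w S), ?_, ?_⟩
  · intro S hS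
    simp only [ne_eq, ite_eq_left_iff, not_forall] at hS
    obtain ⟨h1, h2⟩ := hS
    have h3 := hc _ (right_ne_zero_of_mul h2)
    rw [hw, Finset.card_insert_of_notMem h1] at h3
    refine ⟨h3.1, ?_⟩
    have := h3.2
    push_cast at this
    linarith
  · intro S hS
    rw [coboundary_apply]
    by_cases hwS : w ∈ S
    · rw [Finset.sum_eq_single_of_mem w hwS]
      · rw [if_neg (Finset.notMem_erase w S), Finset.insert_erase hwS, ← mul_assoc,
          faceSign_mul_self, one_mul]
      · intro v _ hv
        rw [if_pos (Finset.mem_erase.2 ⟨hv.symm, hwS⟩), mul_zero]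
    · have h := hz _ ((hw S).2 hS)
      rw [coboundary_apply, Finset.sum_insert hwS, Finset.erase_insert hwS] at h
      have h' := congrArg (faceSign K (insert w S) w * ·) h
      simp only [mul_add, mul_zero, ← mul_assoc, faceSign_mul_self, one_mul] at h'
      rw [← sub_eq_zero, ← neg_eq_zero, neg_sub, ← h', sub_eq_add_neg, add_right_inj,
        Finset.mul_sum, ← Finset.sum_neg_distrib]
      refine Finset.sum_congr rfl fun v hv => ?_
      have hvw : v ≠ w := fun h => hwS (h ▸ hv)
      have hins : insert w (S.erase v) = (insert w S).erase v :=
        (Finset.erase_insert_of_ne hvw.symm).symm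
      rw [if_neg (fun h => hwS (Finset.mem_of_mem_erase h)), hins]
      have hs := faceSign_mul_faceSign_erase K (Finset.mem_insert_of_mem hv)
        (Finset.mem_insert_self w S) hvw
      rw [Finset.erase_insert hwS] at hs
      -- all signs square to `1`, so this is `hs` multiplied by two of them
      have e1 : faceSign K S v * faceSign K ((insert w S).erase v) w =
          -(faceSign K (insert w S) w * faceSign K (insert w S) v) := by
        have := faceSign_mul_self K (insert w S) w
        have h2 := faceSign_mul_self K (insert w S) v
        calc _ = (faceSign K (insert w S) w * faceSign K S v) *
              faceSign K ((insert w S).erase v) w * faceSign K (insert w S) w := by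
                linear_combination (-faceSign K S v * faceSign K ((insert w S).erase v) w) * this
          _ = _ := by
                rw [hs]
                have h3 := faceSign_mul_self K ((insert w S).erase v) w
                linear_combination
                  (-faceSign K (insert w S) v * faceSign K (insert w S) w) * h3
      rw [← mul_assoc, e1]; ring

/-! ### Cochains of a star and chains of the link -/

variable (K) in
/-- The sign `(-1)^{#{(u, v) ∈ F × T : u < v}}` that compares the orientations of `T` and of
`T ∪ F`. -/
def joinSign (F T : Finset σ) : K := ∏ v ∈ T, faceSign K F v

variable (K) in
theorem joinSign_mul_self (F T : Finset σ) : joinSign K F T * joinSign K F T = 1 := by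
  rw [joinSign, ← Finset.prod_mul_distrib]
  exact Finset.prod_eq_one fun v _ => faceSign_mul_self K F v

variable (K) in
theorem joinSign_mul_faceSign_union {F T : Finset σ} (h : Disjoint T F) {v : σ} (hv : v ∈ T) :
    joinSign K F T * faceSign K (T ∪ F) v = faceSign K T v * joinSign K F (T.erase v) := by
  have h1 : faceSign K (T ∪ F) v = faceSign K T v * faceSign K F v := by
    rw [faceSign, Finset.filter_union, Finset.card_union_of_disjoint
      (Finset.disjoint_filter_filter h), pow_add]
    rfl
  have h2 : joinSign K F T = faceSign K F v * joinSign K F (T.erase v) :=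
    (Finset.mul_prod_erase _ _ hv).symm
  rw [h1, h2]
  linear_combination (faceSign K T v * joinSign K F (T.erase v)) * faceSign_mul_self K F v

variable (K) in
/-- The pairing of a cochain `c` with chains, by which `c` takes on a simplex `T` the value
`± c (T ∪ F)`. -/
noncomputable def joinPairing (F : Finset σ) :
    (Finset σ → K) →ₗ[K] Module.Dual K (Finset σ →₀ K) where
  toFun c := Finsupp.linearCombination K (fun T => joinSign K F T * c (T ∪ F))
  map_add' c c' := by ext T; simp [mul_add]
  map_smul' r c := by ext T; simp [mul_left_comm]

theorem joinPairing_single (F : Finset σ) (c : Finset σ → K) (T : Finset σ) :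
    joinPairing K F c (Finsupp.single T 1) = joinSign K F T * c (T ∪ F) := by
  simp [joinPairing]

/-- The coboundary is adjoint to the boundary. -/
theorem joinPairing_boundary_single {F : Finset σ} {c : Finset σ → K}
    (hc : ∀ S, c S ≠ 0 → F ⊆ S) {T : Finset σ} (h : Disjoint T F) :
    joinPairing K F c (boundary K (Finsupp.single T 1)) =
      joinSign K F T * coboundary K c (T ∪ F) := by
  rw [boundary_single, map_sum, coboundary_apply, Finset.sum_union h]
  have h0 : ∑ v ∈ F, faceSign K (T ∪ F) v * c ((T ∪ F).erase v) = 0 := by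
    refine Finset.sum_eq_zero fun v hv => ?_
    by_contra h'
    exact Finset.notMem_erase v _ (hc _ (right_ne_zero_of_mul h') hv)
  rw [h0, add_zero, Finset.mul_sum]
  refine Finset.sum_congr rfl fun v hv => ?_
  rw [map_smul, joinPairing_single, smul_eq_mul, ← mul_assoc, ← mul_assoc,
    joinSign_mul_faceSign_union K h hv, Finset.erase_union_distrib,
    Finset.erase_eq_of_notMem (Finset.disjoint_left.1 h hv)]

section Duality

variable {Δ : LowerSet (Finset σ)} {W F G : Finset σ}

/-- The sets `S` with `F ⊆ S ⊆ W` and `S ∪ G ∈ Δ`: the faces of `lk_Δ G` in `W` that contain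
`F`. -/
def starSets (Δ : LowerSet (Finset σ)) (W F G : Finset σ) : Set (Finset σ) :=
  {S | F ⊆ S ∧ S ⊆ W ∧ S ∪ G ∈ Δ}

theorem mem_restrict_link {T A : Finset σ} :
    T ∈ restrict (link Δ A) W ↔ (T ∪ A ∈ Δ ∧ Disjoint T A) ∧ T ⊆ W := Iff.rfl

theorem union_mem_starSets (hF : F ⊆ W) {T : Finset σ}
    (hT : T ∈ restrict (link Δ (F ∪ G)) W) : T ∪ F ∈ starSets Δ W F G := by
  rw [mem_restrict_link] at hT
  refine ⟨Finset.subset_union_right, Finset.union_subset hT.2 hF, ?_⟩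
  rw [Finset.union_assoc]
  exact hT.1.1

theorem sdiff_mem_restrict_link (hG : Disjoint G W) {S : Finset σ} (hS : S ∈ starSets Δ W F G) :
    S \ F ∈ restrict (link Δ (F ∪ G)) W := by
  obtain ⟨h1, h2, h3⟩ := hS
  refine mem_restrict_link.2 ⟨⟨?_, ?_⟩, Finset.sdiff_subset.trans h2⟩
  · rwa [← Finset.union_assoc, Finset.sdiff_union_of_subset h1]
  · rw [Finset.disjoint_union_right]
    exact ⟨Finset.sdiff_disjoint, (hG.mono_right (Finset.sdiff_subset.trans h2)).symm⟩

theorem card_sdiff_cast {S : Finset σ} (h : F ⊆ S) : ((S \ F).card : ℤ) = S.card - F.card := by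
  rw [Finset.card_sdiff_of_subset h, Nat.cast_sub (Finset.card_le_card h)]

open scoped Classical in
/-- Every functional on chains of the link is the pairing with a cochain. -/
theorem exists_isCochain_joinPairing_eq (hF : F ⊆ W) (t : ℤ)
    (g : Module.Dual K (Finset σ →₀ K)) :
    ∃ c, IsCochain (starSets Δ W F G) t c ∧
      ∀ x ∈ chains K (restrict (link Δ (F ∪ G)) W) (t - F.card - 1), joinPairing K F c x = g x := by
  refine ⟨fun S => if S ∈ starSets Δ W F G ∧ (S.card : ℤ) = t then
    joinSign K F (S \ F) * g (Finsupp.single (S \ F) 1) else 0, ?_, ?_⟩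
  · intro S hS
    by_contra h
    exact hS (if_neg h)
  · intro x hx
    refine linearMap_eq_of_mem_chains K (fun T hT hc => ?_) hx
    have hd : Disjoint T F := (Finset.disjoint_union_right.1 (mem_restrict_link.1 hT).1.2).1
    have ht : ((T ∪ F).card : ℤ) = t := by
      rw [Finset.card_union_of_disjoint hd]
      push_cast
      rw [hc]; ring
    rw [joinPairing_single, if_pos ⟨union_mem_starSets hF hT, ht⟩, Finset.union_sdiff_right,
      Finset.sdiff_eq_self_of_disjoint hd, ← mul_assoc, joinSign_mul_self, one_mul]

theorem IsCochain.subset_of_starSets {t : ℤ} {c : Finset σ → K}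
    (hc : IsCochain (starSets Δ W F G) t c) (S : Finset σ) (h : c S ≠ 0) : F ⊆ S := (hc S h).1.1

/-- A cocycle pairs to zero with all boundaries. -/
theorem joinPairing_eq_zero_of_mem_boundaries (hF : F ⊆ W) {t : ℤ} {c : Finset σ → K}
    (hc : IsCochain (starSets Δ W F G) t c)
    (hz : ∀ S ∈ starSets Δ W F G, coboundary K c S = 0) {q : ℤ} {x : Finset σ →₀ K}
    (hx : x ∈ boundaries K (restrict (link Δ (F ∪ G)) W) q) : joinPairing K F c x = 0 := by
  obtain ⟨x, hx, rfl⟩ := hx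
  refine linearMap_eq_of_mem_chains K (f := (joinPairing K F c).comp (boundary K)) (g := 0)
    (fun T hT _ => ?_) hx
  have hd : Disjoint T F := (Finset.disjoint_union_right.1 (mem_restrict_link.1 hT).1.2).1
  rw [LinearMap.comp_apply, joinPairing_boundary_single hc.subset_of_starSets hd,
    hz _ (union_mem_starSets hF hT), mul_zero, LinearMap.zero_apply]

/-- A coboundary pairs to zero with all cycles. -/
theorem joinPairing_eq_zero_of_mem_cycles (hF : F ⊆ W) {t : ℤ} {b c : Finset σ → K}
    (hb : IsCochain (starSets Δ W F G) t b)
    (hbc : ∀ S ∈ starSets Δ W F G, coboundary K b S = c S) {q : ℤ} {x : Finset σ →₀ K}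
    (hx : x ∈ cycles K (restrict (link Δ (F ∪ G)) W) q) : joinPairing K F c x = 0 := by
  have h : joinPairing K F c x = joinPairing K F b (boundary K x) := by
    refine linearMap_eq_of_mem_chains K (g := (joinPairing K F b).comp (boundary K))
      (fun T hT _ => ?_) hx.1
    have hd : Disjoint T F := (Finset.disjoint_union_right.1 (mem_restrict_link.1 hT).1.2).1
    rw [LinearMap.comp_apply, joinPairing_boundary_single hb.subset_of_starSets hd,
      hbc _ (union_mem_starSets hF hT), joinPairing_single]
  rw [h, LinearMap.mem_ker.1 hx.2, map_zero]

/-- A functional on cycles which vanishes on boundaries is the pairing with a cocycle. -/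
theorem exists_cocycle_joinPairing_eq (hF : F ⊆ W) (hG : Disjoint G W) (t : ℤ)
    (g : Module.Dual K (cycles K (restrict (link Δ (F ∪ G)) W) (t - F.card - 1)))
    (hg : ∀ x, x.1 ∈ boundaries K (restrict (link Δ (F ∪ G)) W) (t - F.card - 1) → g x = 0) :
    ∃ c, IsCochain (starSets Δ W F G) t c ∧ (∀ S ∈ starSets Δ W F G, coboundary K c S = 0) ∧
      ∀ x, joinPairing K F c x.1 = g x := by
  obtain ⟨g', hg'⟩ := LinearMap.exists_extend g
  obtain ⟨c, hc, hcg⟩ := exists_isCochain_joinPairing_eq (Δ := Δ) (G := G) hF t g'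
  have hext : ∀ x, g' x.1 = g x := fun x => LinearMap.congr_fun hg' x
  refine ⟨c, hc, fun S hS => ?_, fun x => (hcg _ x.2.1).trans (hext x)⟩
  by_cases hS' : (S.card : ℤ) = t + 1
  · have hmem : boundary K (Finsupp.single (S \ F) 1) ∈
        boundaries K (restrict (link Δ (F ∪ G)) W) (t - F.card - 1) :=
      Submodule.mem_map_of_mem (single_mem_chains K (sdiff_mem_restrict_link hG hS)
        (by rw [card_sdiff_cast hS.1, hS']; ring))
    have h1 := joinPairing_boundary_single hc.subset_of_starSets
      (Finset.sdiff_disjoint : Disjoint (S \ F) F)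
    have hcyc := boundaries_le_cycles K _ _ hmem
    rw [hcg _ hcyc.1, hext ⟨_, hcyc⟩, hg _ hmem, Finset.sdiff_union_of_subset hS.1] at h1
    rcases mul_eq_zero.1 h1.symm with h | h
    · have := joinSign_mul_self K F (S \ F)
      simp [h] at this
    · exact h
  · exact hc.coboundary_eq_zero hS'

/-- A cochain which pairs to zero with all cycles is a coboundary. -/
theorem exists_coboundary_of_joinPairing_eq_zero (hF : F ⊆ W) (hG : Disjoint G W) {t : ℤ}
    {c : Finset σ → K} (hc : IsCochain (starSets Δ W F G) t c)
    (h : ∀ x ∈ cycles K (restrict (link Δ (F ∪ G)) W) (t - F.card - 1), joinPairing K F c x = 0) :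
    ∃ b, IsCochain (starSets Δ W F G) (t - 1) b ∧
      ∀ S ∈ starSets Δ W F G, coboundary K b S = c S := by
  -- The pairing with `c` kills the kernel of the boundary map on chains, so it factors through it.
  obtain ⟨g, hg⟩ := exists_dual_apply_eq (boundary K) (joinPairing K F c)
    (C := chains K (restrict (link Δ (F ∪ G)) W) (t - F.card - 1)) fun x hx hx' => h x ⟨hx, hx'⟩
  obtain ⟨b, hb, hbg⟩ := exists_isCochain_joinPairing_eq (Δ := Δ) (G := G) hF (t - 1) g
  refine ⟨b, hb, fun S hS => ?_⟩
  by_cases hS' : (S.card : ℤ) = t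
  · have hT : Finsupp.single (S \ F) (1 : K) ∈
        chains K (restrict (link Δ (F ∪ G)) W) (t - F.card - 1) :=
      single_mem_chains K (sdiff_mem_restrict_link hG hS) (by rw [card_sdiff_cast hS.1, hS']; ring)
    have h1 := joinPairing_boundary_single hb.subset_of_starSets
      (Finset.sdiff_disjoint : Disjoint (S \ F) F)
    have hT' : boundary K (Finsupp.single (S \ F) 1) ∈
        chains K (restrict (link Δ (F ∪ G)) W) (t - 1 - F.card - 1) := by
      refine boundary_mem_chains K ?_
      convert hT using 2
      ring
    rw [hbg _ hT', Finset.sdiff_union_of_subset hS.1] at h1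
    have h2 : g (boundary K (Finsupp.single (S \ F) 1)) =
        joinPairing K F c (Finsupp.single (S \ F) 1) := hg _ hT
    rw [h2, joinPairing_single, Finset.sdiff_union_of_subset hS.1] at h1
    refine (mul_left_cancel₀ (fun h => ?_) h1).symm
    have := joinSign_mul_self K F (S \ F)
    simp [h] at this
  · rw [hb.coboundary_eq_zero (by simpa using hS')]
    by_contra h'
    exact hS' (hc S (Ne.symm h')).2

end Duality

end Combinatorics

/-! ### Counting exponents with prescribed signs and totals -/

section Counting

variable {σ : Type*} [Fintype σ] [DecidableEq σ]

open scoped Classical in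
/-- The integral functions with total `k` which are positive on `S` and zero off `S`. -/
noncomputable def positiveFunctions (S : Finset σ) (k : ℤ) : Finset (σ → ℤ) :=
  (Finset.Icc 0 (fun _ => k)).filter
    (fun f => (∀ v ∈ S, 1 ≤ f v) ∧ (∀ v ∉ S, f v = 0) ∧ ∑ v ∈ S, f v = k)

theorem mem_positiveFunctions {S : Finset σ} {k : ℤ} {f : σ → ℤ} :
    f ∈ positiveFunctions S k ↔
      (∀ v ∈ S, 1 ≤ f v) ∧ (∀ v ∉ S, f v = 0) ∧ ∑ v ∈ S, f v = k := by
  rw [positiveFunctions, Finset.mem_filter, and_iff_right_iff_imp, Finset.mem_Icc]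
  rintro ⟨h1, h2, h3⟩
  have h0 : ∀ v, 0 ≤ f v := fun v => by
    by_cases hv : v ∈ S
    · linarith [h1 v hv]
    · exact (h2 v hv).ge
  refine ⟨h0, fun v => ?_⟩
  by_cases hv : v ∈ S
  · exact h3 ▸ Finset.single_le_sum (fun u _ => h0 u) hv
  · rw [h2 v hv, ← h3]
    exact Finset.sum_nonneg fun u _ => h0 u

theorem binom_add_natCast (g n : ℕ) :
    binom ((g + n : ℤ) - 1) ((g : ℤ) - 1) = (g + n - 1).choose n := by
  rcases Nat.eq_zero_or_pos g with rfl | hg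
  · rcases Nat.eq_zero_or_pos n with rfl | hn
    · simp [binom]
    · rw [binom, if_neg (by omega), if_neg (by omega), Nat.choose_eq_zero_of_lt (by omega)]
  · rw [binom, if_neg (by omega), if_pos (by omega)]
    have h1 : ((g + n : ℤ) - 1).toNat = g + n - 1 := by omega
    have h2 : ((g : ℤ) - 1).toNat = g - 1 := by omega
    rw [h1, h2]
    exact Nat.choose_symm_of_eq_add (by omega)

theorem card_positiveFunctions (S : Finset σ) (k : ℤ) :
    (positiveFunctions S k).card = binom (k - 1) ((S.card : ℤ) - 1) := by
  by_cases hk : (S.card : ℤ) ≤ k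
  · obtain ⟨n, rfl⟩ := Int.le.dest hk
    rw [binom_add_natCast, ← Finset.card_finsuppAntidiag_nat_eq_choose]
    symm
    -- subtracting `1` on `S` leaves a function with values in `ℕ` and total `k - |S|`
    refine Finset.card_bij (fun f _ v => if v ∈ S then (f v : ℤ) + 1 else 0) ?_ ?_ ?_
    · intro f hf
      rw [Finset.mem_finsuppAntidiag] at hf
      refine mem_positiveFunctions.2 ⟨fun v hv => by simp [hv], fun v hv => by simp [hv], ?_⟩
      rw [Finset.sum_congr rfl (fun v hv => if_pos hv), Finset.sum_add_distrib, ← hf.1]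
      push_cast
      simp [add_comm]
    · intro f hf g hg h
      rw [Finset.mem_finsuppAntidiag] at hf hg
      ext v
      by_cases hv : v ∈ S
      · have := congrFun h v
        simpa [hv] using this
      · rw [Finsupp.notMem_support_iff.1 fun h => hv (hf.2 h),
          Finsupp.notMem_support_iff.1 fun h => hv (hg.2 h)]
    · intro a ha
      obtain ⟨h1, h2, h3⟩ := mem_positiveFunctions.1 ha
      have key : ∀ v ∈ S, (((a v - 1).toNat : ℕ) : ℤ) = a v - 1 := fun v hv =>
        Int.toNat_of_nonneg (by linarith [h1 v hv])
      refine ⟨Finsupp.onFinset S (fun v => if v ∈ S then (a v - 1).toNat else 0)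
        (by simp +contextual), ?_, ?_⟩
      · rw [Finset.mem_finsuppAntidiag]
        refine ⟨?_, Finsupp.support_onFinset_subset⟩
        have hs : ∑ v ∈ S, ((if v ∈ S then (a v - 1).toNat else 0 : ℕ) : ℤ) = n := by
          rw [Finset.sum_congr rfl (fun v hv => by rw [if_pos hv, key v hv]),
            Finset.sum_sub_distrib, h3]
          simp
        exact_mod_cast hs
      · funext v
        by_cases hv : v ∈ S
        · simp only [hv, if_true, Finsupp.onFinset_apply]
          rw [key v hv]; ring
        · simp [hv, h2 v hv]
  -- fewer than `|S|` units cannot be spread over `S`, and the binomial coefficient vanishes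
  · have h1 : positiveFunctions S k = ∅ := by
      refine Finset.eq_empty_of_forall_notMem fun f hf => hk ?_
      obtain ⟨h1, h2, h3⟩ := mem_positiveFunctions.1 hf
      rw [← h3]
      simpa using Finset.sum_le_sum h1
    rw [h1, Finset.card_empty, binom, if_neg (by omega)]
    split_ifs with h
    · exact (Nat.choose_eq_zero_of_lt (by omega)).symm
    · rfl

/-- The number of integral functions which are positive on `G` with total `k`, negative on `F` with
total `j`, and zero elsewhere. -/
theorem card_eq_binom_mul_binom {F G : Finset σ} (hFG : Disjoint F G) (k j : ℤ)
    {N : Finset (σ → ℤ)} (hN : ∀ a, a ∈ N ↔ (∀ v ∈ G, 1 ≤ a v) ∧ (∀ v ∈ F, a v ≤ -1) ∧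
      (∀ v, v ∉ F → v ∉ G → a v = 0) ∧ ∑ v ∈ G, a v = k ∧ ∑ v ∈ F, a v = j) :
    N.card = binom (k - 1) ((G.card : ℤ) - 1) * binom (-j - 1) ((F.card : ℤ) - 1) := by
  rw [← card_positiveFunctions, ← card_positiveFunctions, ← Finset.card_product]
  have hd := Finset.disjoint_left.1 hFG
  have hd' := Finset.disjoint_right.1 hFG
  refine Finset.card_nbij' (fun a => (fun v => if v ∈ G then a v else 0,
    fun v => if v ∈ F then -a v else 0)) (fun p v => p.1 v - p.2 v) ?_ ?_ ?_ ?_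
  · intro a ha
    obtain ⟨h1, h2, h3, h4, h5⟩ := (hN a).1 ha
    simp only [Finset.mem_coe, Finset.mem_product, mem_positiveFunctions]
    refine ⟨⟨fun v hv => by simpa [hv] using h1 v hv, fun v hv => by simp [hv], ?_⟩,
      ⟨fun v hv => by simp only [hv, if_true]; linarith [h2 v hv], fun v hv => by simp [hv], ?_⟩⟩
    · rw [← h4]
      exact Finset.sum_congr rfl fun v hv => if_pos hv
    · rw [← h5, ← Finset.sum_neg_distrib]
      exact Finset.sum_congr rfl fun v hv => if_pos hv
  · rintro ⟨f, g⟩ hp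
    simp only [Finset.mem_coe, Finset.mem_product, mem_positiveFunctions] at hp
    obtain ⟨⟨h1, h2, h3⟩, ⟨h4, h5, h6⟩⟩ := hp
    refine (hN _).2 ⟨fun v hv => ?_, fun v hv => ?_, fun v hv hv' => ?_, ?_, ?_⟩
    · simpa [h5 v (hd' hv)] using h1 v hv
    · have := h4 v hv
      simp only [h2 v (hd hv)]
      linarith
    · simp [h2 v hv', h5 v hv]
    · rw [← h3]
      exact Finset.sum_congr rfl fun v hv => by simp [h5 v (hd' hv)]
    · rw [← neg_neg j, ← h6, ← Finset.sum_neg_distrib]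
      exact Finset.sum_congr rfl fun v hv => by simp [h2 v (hd hv)]
  · intro a ha
    obtain ⟨-, -, h3, -, -⟩ := (hN a).1 ha
    funext v
    by_cases hF : v ∈ F
    · simp [hF, hd hF]
    · by_cases hG : v ∈ G
      · simp [hF, hG]
      · simp [hF, hG, h3 v hF hG]
  · rintro ⟨f, g⟩ hp
    simp only [Finset.mem_coe, Finset.mem_product, mem_positiveFunctions] at hp
    obtain ⟨⟨h1, h2, h3⟩, ⟨h4, h5, h6⟩⟩ := hp
    refine Prod.ext ?_ ?_
    · funext v
      by_cases hG : v ∈ G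
      · simp [hG, h5 v (hd' hG)]
      · simp [hG, h2 v hG]
    · funext v
      by_cases hF : v ∈ F
      · simp [hF, h2 v (hd hF)]
      · simp [hF, h5 v hF]

end Counting

/-! ### Monomials in the Stanley–Reisner ring -/

section Monomials

variable (K : Type*) [Field K] {σ : Type*}

/-- The homomorphism to the Laurent polynomials which keeps the variables in `T` and kills the
others. -/
noncomputable def faceEval [DecidableEq σ] (T : Finset σ) :
    MvPolynomial σ K →ₐ[K] AddMonoidAlgebra K (σ → ℤ) :=
  MvPolynomial.aeval fun v => if v ∈ T then AddMonoidAlgebra.single (Pi.single v 1) 1 else 0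

theorem faceEval_monomial [DecidableEq σ] {T : Finset σ} {c : σ →₀ ℕ} (hc : ∀ v, c v ≠ 0 → v ∈ T) :
    faceEval K T (MvPolynomial.monomial c 1) =
      AddMonoidAlgebra.single (fun v => (c v : ℤ)) 1 := by
  induction c using Finsupp.induction_linear with
  | zero =>
    rw [MvPolynomial.monomial_zero', MvPolynomial.C_1, map_one, AddMonoidAlgebra.one_def]
    rfl
  | add c d hc' hd' =>
    rw [← mul_one (1 : K), ← MvPolynomial.monomial_mul, map_mul, mul_one,
      hc' fun v hv => hc v (by simp [hv]), hd' fun v hv => hc v (by simp [hv]),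
      AddMonoidAlgebra.single_mul_single, mul_one]
    congr 1
  | single u n =>
    rcases Nat.eq_zero_or_pos n with rfl | hn
    · rw [Finsupp.single_zero, MvPolynomial.monomial_zero', MvPolynomial.C_1, map_one,
        AddMonoidAlgebra.one_def]
      rfl
    · have hu : u ∈ T := hc u (by simp [hn.ne'])
      rw [← MvPolynomial.X_pow_eq_monomial, map_pow, faceEval, MvPolynomial.aeval_X, if_pos hu,
        AddMonoidAlgebra.single_pow, one_pow]
      congr 1
      ext v
      rcases eq_or_ne v u with rfl | h
      · simp
      · simp [h, Finsupp.single_eq_of_ne h]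

theorem faceEval_monomial_eq_zero [DecidableEq σ] {T : Finset σ} {c : σ →₀ ℕ} {u : σ}
    (hu : c u ≠ 0) (huT : u ∉ T) : faceEval K T (MvPolynomial.monomial c 1) = 0 := by
  obtain ⟨d, rfl⟩ : ∃ d, c = d + Finsupp.single u 1 := by
    refine ⟨c - Finsupp.single u 1, (tsub_add_cancel_of_le ?_).symm⟩
    simpa [Finsupp.single_le_iff] using Nat.one_le_iff_ne_zero.2 hu
  rw [← mul_one (1 : K), ← MvPolynomial.monomial_mul, map_mul, ← MvPolynomial.X, faceEval,
    MvPolynomial.aeval_X, if_neg huT, mul_zero]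

theorem faceEval_eq_zero [DecidableEq σ] {Δ : LowerSet (Finset σ)} {T : Finset σ} (hT : T ∈ Δ)
    {f : MvPolynomial σ K} (hf : f ∈ stanleyReisnerIdeal K Δ) : faceEval K T f = 0 := by
  suffices h : stanleyReisnerIdeal K Δ ≤ RingHom.ker (faceEval K T) from h hf
  rw [stanleyReisnerIdeal, Ideal.span_le]
  rintro _ ⟨S, hS, rfl⟩
  obtain ⟨v, hvS, hvT⟩ := Finset.not_subset.1 fun h => hS (Δ.lower h hT)
  rw [SetLike.mem_coe, RingHom.mem_ker, map_prod]
  refine Finset.prod_eq_zero hvS ?_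
  rw [faceEval, MvPolynomial.aeval_X, if_neg hvT]

variable (Δ : LowerSet (Finset σ))

/-- The residue class in `K[Δ]` of the monomial with exponent `c`. -/
noncomputable def srMonomial (c : σ →₀ ℕ) : StanleyReisnerRing K Δ :=
  Ideal.Quotient.mk _ (MvPolynomial.monomial c 1)

theorem srMonomial_add (c d : σ →₀ ℕ) :
    srMonomial K Δ (c + d) = srMonomial K Δ c * srMonomial K Δ d := by
  rw [srMonomial, srMonomial, srMonomial, ← map_mul, MvPolynomial.monomial_mul, mul_one]

theorem srMonomial_nsmul (l : ℕ) (c : σ →₀ ℕ) :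
    srMonomial K Δ (l • c) = srMonomial K Δ c ^ l := by
  rw [srMonomial, srMonomial, ← map_pow, MvPolynomial.monomial_pow, one_pow]

theorem prod_X_eq_monomial (S : Finset σ) :
    ∏ v ∈ S, (MvPolynomial.X v : MvPolynomial σ K) =
      MvPolynomial.monomial (∑ v ∈ S, Finsupp.single v 1) 1 := by
  classical
  induction S using Finset.induction_on with
  | empty => simp
  | insert v S hv ih =>
    rw [Finset.prod_insert hv, Finset.sum_insert hv, ih, MvPolynomial.X,
      MvPolynomial.monomial_mul, mul_one]

theorem sum_single_one_apply [DecidableEq σ] (S : Finset σ) (v : σ) :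
    (∑ u ∈ S, Finsupp.single u 1 : σ →₀ ℕ) v = if v ∈ S then 1 else 0 := by
  simp [Finsupp.finsetSum_apply, Finsupp.single_apply]

theorem nsmul_sum_single_apply [DecidableEq σ] (l : ℕ) (S : Finset σ) (v : σ) :
    (l • ∑ u ∈ S, Finsupp.single u 1 : σ →₀ ℕ) v = if v ∈ S then l else 0 := by
  rw [Finsupp.smul_apply, sum_single_one_apply]
  simp

variable {K Δ} in
theorem srMonomial_eq_zero {T : Finset σ} (hT : T ∉ Δ) {c : σ →₀ ℕ} (hc : ∀ v ∈ T, c v ≠ 0) :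
    srMonomial K Δ c = 0 := by
  classical
  have hle : (∑ u ∈ T, Finsupp.single u 1 : σ →₀ ℕ) ≤ c := fun v => by
    rw [sum_single_one_apply]
    split_ifs with h
    · exact Nat.one_le_iff_ne_zero.2 (hc v h)
    · exact Nat.zero_le _
  rw [← tsub_add_cancel_of_le hle, srMonomial_add]
  have : srMonomial K Δ (∑ u ∈ T, Finsupp.single u 1) = 0 := by
    rw [srMonomial, Ideal.Quotient.eq_zero_iff_mem, ← prod_X_eq_monomial]
    exact Ideal.subset_span ⟨T, hT, rfl⟩
  rw [this, mul_zero]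

end Monomials

/-! ### The monomial basis of the localizations -/

section Coefficients

variable (K : Type*) [Field K] {σ : Type*} (Δ : LowerSet (Finset σ)) (W : Finset σ)

/-- A set of elements of `W` as a set of vertices. -/
def vertices {W : Finset σ} (U : Finset W) : Finset σ := U.map (Function.Embedding.subtype _)

theorem prod_yVar (U : Finset W) :
    ∏ w ∈ U, yVar K Δ W w = srMonomial K Δ (∑ v ∈ vertices U, Finsupp.single v 1) := by
  rw [srMonomial, ← prod_X_eq_monomial, map_prod, vertices, Finset.prod_map]
  rfl

/-- The fraction `p / y_U ^ l`, as a linear function of the polynomial `p`. -/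
noncomputable def fraction (U : Finset W) (l : ℕ) :
    MvPolynomial σ K →ₗ[K] CechTerm (yVar K Δ W) U :=
  (LinearMap.mulRight K (Localization.mk 1 (⟨(∏ w ∈ U, yVar K Δ W w) ^ l, ⟨l, rfl⟩⟩ :
    Submonoid.powers (∏ w ∈ U, yVar K Δ W w)) : CechTerm (yVar K Δ W) U)).comp
    ((IsScalarTower.toAlgHom K (StanleyReisnerRing K Δ) (CechTerm (yVar K Δ W) U)).toLinearMap.comp
      (Ideal.Quotient.mkₐ K (stanleyReisnerIdeal K Δ)).toLinearMap)

theorem fraction_apply (U : Finset W) (l : ℕ) (p : MvPolynomial σ K) :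
    fraction K Δ W U l p = Localization.mk (Ideal.Quotient.mk _ p)
      (⟨(∏ w ∈ U, yVar K Δ W w) ^ l, ⟨l, rfl⟩⟩ :
        Submonoid.powers (∏ w ∈ U, yVar K Δ W w)) := by
  simp only [fraction, LinearMap.comp_apply, LinearMap.mulRight_apply, AlgHom.toLinearMap_apply,
    IsScalarTower.coe_toAlgHom', Ideal.Quotient.mkₐ_eq_mk]
  rw [← Localization.mk_algebraMap, Localization.mk_mul, mul_one, one_mul]
  rfl

theorem exists_fraction_eq {U : Finset W} (z : CechTerm (yVar K Δ W) U) :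
    ∃ l p, fraction K Δ W U l p = z := by
  induction z using Localization.induction_on with
  | H y =>
    obtain ⟨r, ⟨_, l, rfl⟩⟩ := y
    obtain ⟨p, rfl⟩ := Ideal.Quotient.mk_surjective r
    exact ⟨l, p, fraction_apply K Δ W U l p⟩

theorem fraction_monomial_mul (U : Finset W) (l : ℕ) (c : σ →₀ ℕ) :
    fraction K Δ W U l (MvPolynomial.monomial c 1) *
      algebraMap (StanleyReisnerRing K Δ) _
        (srMonomial K Δ (l • ∑ v ∈ vertices U, Finsupp.single v 1)) =
      algebraMap (StanleyReisnerRing K Δ) _ (srMonomial K Δ c) := by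
  rw [fraction_apply, srMonomial_nsmul, ← prod_yVar, Localization.mk_eq_mk'_apply]
  exact IsLocalization.mk'_spec _ _ _

theorem isUnit_algebraMap_srMonomial (U : Finset W) (l : ℕ) :
    IsUnit (algebraMap (StanleyReisnerRing K Δ) (CechTerm (yVar K Δ W) U)
      (srMonomial K Δ (l • ∑ v ∈ vertices U, Finsupp.single v 1))) := by
  rw [srMonomial_nsmul, ← prod_yVar, map_pow]
  exact (IsLocalization.Away.algebraMap_isUnit _).pow l

variable {K Δ W} in
theorem fraction_monomial_eq {U : Finset W} {l l' : ℕ} {c c' : σ →₀ ℕ}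
    (h : c + l' • ∑ v ∈ vertices U, Finsupp.single v 1 =
      c' + l • ∑ v ∈ vertices U, Finsupp.single v 1) :
    fraction K Δ W U l (MvPolynomial.monomial c 1) =
      fraction K Δ W U l' (MvPolynomial.monomial c' 1) := by
  refine (isUnit_algebraMap_srMonomial K Δ W U (l + l')).mul_right_cancel ?_
  rw [add_smul, srMonomial_add, map_mul]
  have h1 := fraction_monomial_mul K Δ W U l c
  have h2 := fraction_monomial_mul K Δ W U l' c'
  rw [← mul_assoc, h1, mul_comm (algebraMap _ _ (srMonomial K Δ (l • _))), ← mul_assoc, h2,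
    ← map_mul, ← map_mul, ← srMonomial_add, ← srMonomial_add, h]

variable {K Δ W} in
/-- A fraction of monomials vanishes when its numerator, multiplied by `y_U`, is divisible by the
monomial of a nonface. -/
theorem fraction_monomial_eq_zero {U : Finset W} {l : ℕ} {c : σ →₀ ℕ} {T : Finset σ} (hT : T ∉ Δ)
    (hc : ∀ v ∈ T, v ∉ vertices U → c v ≠ 0) :
    fraction K Δ W U l (MvPolynomial.monomial c 1) = 0 := by
  classical
  refine (isUnit_algebraMap_srMonomial K Δ W U (l + 1)).mul_right_cancel ?_
  rw [zero_mul, add_smul, srMonomial_add, map_mul, ← mul_assoc, fraction_monomial_mul, ← map_mul,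
    ← srMonomial_add, one_smul, srMonomial_eq_zero hT, map_zero]
  intro v hv
  rw [Finsupp.add_apply, sum_single_one_apply]
  split_ifs with h
  · exact Nat.succ_ne_zero _
  · simpa using hc v hv h

variable [Fintype σ] [DecidableEq σ]

/-- The set of indices at which `a` does not vanish. -/
def degreeSupport (a : σ → ℤ) : Finset σ := Finset.univ.filter fun v => a v ≠ 0

omit [DecidableEq σ] in
theorem mem_degreeSupport {a : σ → ℤ} {v : σ} : v ∈ degreeSupport a ↔ a v ≠ 0 := by
  simp [degreeSupport]

/-- The exponents `a ∈ ℤ^σ` of the nonzero Laurent monomials in the localization of `K[Δ]` at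
`∏ v ∈ S, X_v`. -/
def IsExponent (S : Finset σ) (a : σ → ℤ) : Prop :=
  (∀ v ∉ S, 0 ≤ a v) ∧ S ∪ degreeSupport a ∈ Δ

variable {Δ W} in
omit [Fintype σ] in
theorem isUnit_faceEval_prod_yVar {U : Finset W} {T : Finset σ} (hT : T ∈ Δ)
    (hU : vertices U ⊆ T) :
    IsUnit (Ideal.Quotient.liftₐ (stanleyReisnerIdeal K Δ) (faceEval K T)
      (fun _ hf => faceEval_eq_zero K hT hf) (∏ w ∈ U, yVar K Δ W w)) := by
  rw [prod_yVar, srMonomial]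
  change IsUnit (faceEval K T _)
  rw [faceEval_monomial]
  · refine IsUnit.of_mul_eq_one (AddMonoidAlgebra.single (fun v =>
      -(((∑ u ∈ vertices U, Finsupp.single u 1 : σ →₀ ℕ) v : ℕ) : ℤ)) 1) ?_
    rw [AddMonoidAlgebra.single_mul_single, AddMonoidAlgebra.one_def, mul_one]
    congr 1
    ext v
    simp
  · intro v hv
    rw [sum_single_one_apply] at hv
    by_contra h
    exact hv (if_neg fun h' => h (hU h'))

variable {Δ W} in
/-- The extension to `R_{y_U}` of the evaluation at a face `T` containing `U`. -/
noncomputable def localFaceEval {U : Finset W} {T : Finset σ} (hT : T ∈ Δ) (hU : vertices U ⊆ T) :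
    CechTerm (yVar K Δ W) U →ₐ[K] AddMonoidAlgebra K (σ → ℤ) :=
  IsLocalization.Away.liftAlgHom (∏ w ∈ U, yVar K Δ W w) (isUnit_faceEval_prod_yVar K hT hU)

variable {K Δ W} in
omit [Fintype σ] in
theorem localFaceEval_algebraMap {U : Finset W} {T : Finset σ} (hT : T ∈ Δ) (hU : vertices U ⊆ T)
    (c : σ →₀ ℕ) : localFaceEval K hT hU (algebraMap _ _ (srMonomial K Δ c)) =
      faceEval K T (MvPolynomial.monomial c 1) :=
  IsLocalization.Away.lift_eq _ (isUnit_faceEval_prod_yVar K hT hU) _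

open scoped Classical in
/-- The coefficient of the Laurent monomial with exponent `a` in an element of `R_{y_U}`; it is
read off after evaluation at the face `U ∪ supp a`, and is `0` by convention when the monomial
vanishes. -/
noncomputable def coefficient (U : Finset W) (a : σ → ℤ) : CechTerm (yVar K Δ W) U →ₗ[K] K :=
  if h : IsExponent Δ (vertices U) a then
    (Finsupp.lapply a).comp ((AddMonoidAlgebra.coeffLinearEquiv K).toLinearMap.comp
      (localFaceEval K h.2 Finset.subset_union_left).toLinearMap)
  else 0

theorem coefficient_eq_zero {U : Finset W} {a : σ → ℤ} (h : ¬ IsExponent Δ (vertices U) a)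
    (z : CechTerm (yVar K Δ W) U) : coefficient K Δ W U a z = 0 := by
  rw [coefficient, dif_neg h, LinearMap.zero_apply]

variable {K Δ W} in
open scoped Classical in
/-- The coefficients of a fraction of monomials `X ^ c / X ^ e`. The hypothesis characterizes the
fraction without reference to its denominator being a power of `y_U`, so that images under the
restriction maps are covered as well. -/
theorem coefficient_of_mul_eq {U : Finset W} {z : CechTerm (yVar K Δ W) U} {c e : σ →₀ ℕ}
    (he : ∀ v, e v ≠ 0 → v ∈ vertices U)
    (h : z * algebraMap (StanleyReisnerRing K Δ) _ (srMonomial K Δ e) =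
      algebraMap (StanleyReisnerRing K Δ) _ (srMonomial K Δ c)) (a : σ → ℤ) :
    coefficient K Δ W U a z =
      if IsExponent Δ (vertices U) a ∧ ∀ v, a v = c v - e v then 1 else 0 := by
  by_cases ha : IsExponent Δ (vertices U) a
  swap
  · rw [coefficient_eq_zero K Δ W ha, if_neg fun h => ha h.1]
  have hz : coefficient K Δ W U a z =
      (localFaceEval K ha.2 Finset.subset_union_left z).coeff a := by
    rw [coefficient, dif_pos ha]; rfl
  have h' := congrArg (localFaceEval K ha.2 Finset.subset_union_left) h
  rw [map_mul, localFaceEval_algebraMap, localFaceEval_algebraMap, faceEval_monomial K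
    (fun v hv => Finset.mem_union_left _ (he v hv))] at h'
  have h2 := congrArg (fun x => x.coeff (a + fun v => (e v : ℤ))) h'
  simp only [AddMonoidAlgebra.coeff_mul_single_apply, mul_one] at h2
  rw [← sub_eq_add_neg, add_sub_cancel_right] at h2
  rw [hz, h2]
  by_cases hc : ∀ v, c v ≠ 0 → v ∈ vertices U ∪ degreeSupport a
  · rw [faceEval_monomial K hc, AddMonoidAlgebra.coeff_single, Finsupp.single_apply]
    refine if_congr ?_ rfl rfl
    rw [and_iff_right ha, funext_iff]
    refine forall_congr' fun v => ?_
    simp only [Pi.add_apply]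
    omega
  · push Not at hc
    obtain ⟨u, hu, hu'⟩ := hc
    rw [faceEval_monomial_eq_zero K hu hu', if_neg]
    · rfl
    · rintro ⟨-, h⟩
      rw [Finset.mem_union, not_or, mem_degreeSupport, not_not] at hu'
      have h1 := h u
      have h2 : e u = 0 := by
        by_contra h3
        exact hu'.1 (he u h3)
      rw [hu'.2, h2] at h1
      push_cast at h1
      omega

open scoped Classical in
theorem coefficient_fraction_monomial (U : Finset W) (l : ℕ) (c : σ →₀ ℕ) (a : σ → ℤ) :
    coefficient K Δ W U a (fraction K Δ W U l (MvPolynomial.monomial c 1)) =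
      if IsExponent Δ (vertices U) a ∧ ∀ v, a v = c v - if v ∈ vertices U then (l : ℤ) else 0
      then 1 else 0 := by
  rw [coefficient_of_mul_eq (e := l • ∑ v ∈ vertices U, Finsupp.single v 1) ?_
    (fraction_monomial_mul K Δ W U l c)]
  · simp only [nsmul_sum_single_apply, Nat.cast_ite, Nat.cast_zero]
  · intro v hv
    rw [nsmul_sum_single_apply] at hv
    by_contra h
    exact hv (if_neg h)

/-- A power of `y_U` by which the Laurent monomial with exponent `a` may be multiplied to make its
exponents at `U` nonnegative. -/
def clearingPower (a : σ → ℤ) : ℕ := ∑ v, (a v).natAbs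

/-- The exponent of the numerator of the Laurent monomial with exponent `a`, written with the
denominator `(∏ v ∈ S, X_v) ^ clearingPower a`. -/
noncomputable def numeratorExponent (S : Finset σ) (a : σ → ℤ) : σ →₀ ℕ :=
  Finsupp.equivFunOnFinite.symm fun v =>
    (a v + if v ∈ S then (clearingPower a : ℤ) else 0).toNat

theorem numeratorExponent_apply {S : Finset σ} {a : σ → ℤ} (ha : ∀ v ∉ S, 0 ≤ a v) (v : σ) :
    (numeratorExponent S a v : ℤ) = a v + if v ∈ S then (clearingPower a : ℤ) else 0 := by
  rw [numeratorExponent, Finsupp.coe_equivFunOnFinite_symm]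
  refine Int.toNat_of_nonneg ?_
  split_ifs with h
  · have : (a v).natAbs ≤ clearingPower a :=
      Finset.single_le_sum (f := fun v => (a v).natAbs) (fun _ _ => Nat.zero_le _)
        (Finset.mem_univ v)
    omega
  · simpa using ha v h

open scoped Classical in
/-- The Laurent monomial with exponent `a` in `R_{y_U}`, and `0` if `a` is not the exponent of a
nonzero monomial. -/
noncomputable def laurentMonomial (U : Finset W) (a : σ → ℤ) : CechTerm (yVar K Δ W) U :=
  if IsExponent Δ (vertices U) a then
    fraction K Δ W U (clearingPower a)
      (MvPolynomial.monomial (numeratorExponent (vertices U) a) 1)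
  else 0

open scoped Classical in
theorem coefficient_laurentMonomial (U : Finset W) (a b : σ → ℤ) :
    coefficient K Δ W U a (laurentMonomial K Δ W U b) =
      if IsExponent Δ (vertices U) b ∧ a = b then 1 else 0 := by
  rw [laurentMonomial]
  split_ifs with h h' h'
  · rw [coefficient_fraction_monomial, if_pos]
    refine ⟨h'.2 ▸ h, fun v => ?_⟩
    rw [numeratorExponent_apply h.1, h'.2]
    ring
  · rw [coefficient_fraction_monomial, if_neg]
    rintro ⟨h1, h2⟩
    refine h' ⟨h, funext fun v => ?_⟩
    rw [h2, numeratorExponent_apply h.1]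
    ring
  · exact absurd h'.1 h
  · exact map_zero _

theorem fraction_monomial_mem_span (U : Finset W) (l : ℕ) (c : σ →₀ ℕ) :
    fraction K Δ W U l (MvPolynomial.monomial c 1) ∈
      Submodule.span K (Set.range (laurentMonomial K Δ W U)) := by
  set a : σ → ℤ := fun v => c v - if v ∈ vertices U then (l : ℤ) else 0 with ha
  have hs : ∀ v ∉ vertices U, 0 ≤ a v := fun v hv => by simp [ha, hv]
  by_cases h : vertices U ∪ degreeSupport a ∈ Δ
  · refine Submodule.subset_span ⟨a, ?_⟩
    rw [laurentMonomial, if_pos ⟨hs, h⟩]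
    refine fraction_monomial_eq (Finsupp.ext fun v => ?_)
    rw [Finsupp.add_apply, Finsupp.add_apply, nsmul_sum_single_apply, nsmul_sum_single_apply]
    have h1 := numeratorExponent_apply hs v
    have h2 : a v = c v - if v ∈ vertices U then (l : ℤ) else 0 := rfl
    rw [h2] at h1
    split_ifs at h1 ⊢ <;> omega
  · rw [fraction_monomial_eq_zero h]
    · exact Submodule.zero_mem _
    · intro v hv hv'
      rw [Finset.mem_union, or_iff_right hv', mem_degreeSupport] at hv
      simpa [ha, hv'] using hv

theorem span_laurentMonomial (U : Finset W) :
    Submodule.span K (Set.range (laurentMonomial K Δ W U)) = ⊤ := by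
  refine eq_top_iff.2 fun z _ => ?_
  obtain ⟨l, p, rfl⟩ := exists_fraction_eq K Δ W z
  rw [p.as_sum, map_sum]
  refine Submodule.sum_mem _ fun c _ => ?_
  rw [← mul_one (MvPolynomial.coeff c p), ← smul_eq_mul, ← MvPolynomial.smul_monomial, map_smul]
  exact Submodule.smul_mem _ _ (fraction_monomial_mem_span K Δ W U l c)

variable {K Δ W} in
open scoped Classical in
/-- The Laurent monomials form a basis of `R_{y_U}`, with the coefficients as coordinates. -/
theorem exists_eq_linearCombination {U : Finset W} (z : CechTerm (yVar K Δ W) U) :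
    ∃ p : (σ → ℤ) →₀ K, z = Finsupp.linearCombination K (laurentMonomial K Δ W U) p ∧
      ∀ a, coefficient K Δ W U a z = p a := by
  have hz : z ∈ Submodule.span K (Set.range (laurentMonomial K Δ W U)) := by
    rw [span_laurentMonomial]
    trivial
  rw [← Finsupp.range_linearCombination] at hz
  obtain ⟨p, rfl⟩ := hz
  refine ⟨p.filter (IsExponent Δ (vertices U)), ?_, fun a => ?_⟩
  · conv_lhs => rw [← Finsupp.filter_add_filter_not p (IsExponent Δ (vertices U)), map_add]
    rw [add_eq_left, Finsupp.linearCombination_apply]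
    refine Finset.sum_eq_zero fun a ha => ?_
    rw [Finsupp.support_filter, Finset.mem_filter] at ha
    change _ • laurentMonomial K Δ W U a = 0
    rw [laurentMonomial, if_neg ha.2, smul_zero]
  · rw [Finsupp.linearCombination_apply, Finsupp.sum, map_sum]
    simp only [map_smul, coefficient_laurentMonomial, smul_eq_mul, Finsupp.filter_apply]
    by_cases ha : IsExponent Δ (vertices U) a
    · rw [if_pos ha, Finset.sum_eq_single a]
      · rw [if_pos ⟨ha, rfl⟩, mul_one]
      · intro b _ hb
        rw [if_neg fun h => hb h.2.symm, mul_zero]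
      · intro h
        rw [Finsupp.notMem_support_iff.1 h, zero_mul]
    · rw [if_neg ha]
      refine Finset.sum_eq_zero fun b _ => ?_
      rw [if_neg, mul_zero]
      rintro ⟨h1, rfl⟩
      exact ha h1

variable {K Δ W} in
theorem eq_of_coefficient_eq {U : Finset W} {z z' : CechTerm (yVar K Δ W) U}
    (h : ∀ a, coefficient K Δ W U a z = coefficient K Δ W U a z') : z = z' := by
  obtain ⟨p, hp, hp'⟩ := exists_eq_linearCombination z
  obtain ⟨q, hq, hq'⟩ := exists_eq_linearCombination z'
  rw [hp, hq]
  congr 1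
  ext a
  rw [← hp', ← hq', h]

theorem finite_coefficient_ne_zero {U : Finset W} (z : CechTerm (yVar K Δ W) U) :
    {a | coefficient K Δ W U a z ≠ 0}.Finite := by
  obtain ⟨p, -, hp⟩ := exists_eq_linearCombination z
  simp only [hp]
  exact p.hasFiniteSupport

end Coefficients

/-! ### Restriction maps and bidegrees in terms of coefficients -/

section Grading

variable {K : Type*} [Field K] {σ : Type*} [Fintype σ] [LinearOrder σ] {Δ : LowerSet (Finset σ)}
  {W : Finset σ}

theorem neg_one_pow_ring_smul {R M : Type*} [CommRing R] [AddCommGroup M] [Module R M] [Module K M]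
    (n : ℕ) (x : M) : (-1 : R) ^ n • x = (-1 : K) ^ n • x := by
  rcases Nat.even_or_odd n with h | h
  · simp [h.neg_one_pow]
  · simp [h.neg_one_pow]

open scoped Classical in
/-- The restriction maps of the Čech complex send each Laurent monomial to the one with the same
exponent, or to zero. -/
theorem coefficient_cechRestriction {U U' : Finset W} (h : U ⊆ U') (a : σ → ℤ)
    (z : CechTerm (yVar K Δ W) U) :
    coefficient K Δ W U' a (cechRestriction _ h z) =
      if IsExponent Δ (vertices U') a then coefficient K Δ W U a z else 0 := by
  split_ifs with ha
  swap
  · exact coefficient_eq_zero K Δ W ha _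
  have hlin : (coefficient K Δ W U' a).comp
      ((cechRestriction (yVar K Δ W) h).toLinearMap.restrictScalars K) =
        coefficient K Δ W U a := by
    refine LinearMap.ext_on_range (span_laurentMonomial K Δ W U) fun b => ?_
    simp only [LinearMap.comp_apply, LinearMap.restrictScalars_apply, AlgHom.toLinearMap_apply]
    by_cases hb : IsExponent Δ (vertices U) b
    swap
    · rw [laurentMonomial, if_neg hb, map_zero, map_zero, map_zero]
    rw [laurentMonomial, if_pos hb, coefficient_fraction_monomial, coefficient_of_mul_eq
      (c := numeratorExponent (vertices U) b)
      (e := clearingPower b • ∑ v ∈ vertices U, Finsupp.single v 1)]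
    · refine if_congr ?_ rfl rfl
      have hsub : vertices U ⊆ vertices U' := Finset.map_subset_map.2 h
      simp only [nsmul_sum_single_apply, Nat.cast_ite, Nat.cast_zero]
      refine ⟨fun ⟨_, h2⟩ => ⟨⟨fun v hv => ?_, ?_⟩, h2⟩, fun ⟨_, h2⟩ => ⟨ha, h2⟩⟩
      · rw [h2 v, if_neg hv]
        omega
      · exact Δ.lower (Finset.union_subset_union_left hsub) ha.2
    · intro v hv
      rw [nsmul_sum_single_apply] at hv
      by_contra h'
      exact hv (if_neg fun h'' => h' (Finset.map_subset_map.2 h h''))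
    · rw [← AlgHom.commutes (cechRestriction (yVar K Δ W) h), ← map_mul, fraction_monomial_mul,
        AlgHom.commutes]
  exact LinearMap.congr_fun hlin z

variable (W) in
/-- The bidegree of the Laurent monomial with exponent `a`. -/
def exponentDegree (a : σ → ℤ) : ℤ × ℤ := ∑ v, a v • bidegree W v

theorem exponentDegree_eq (a : σ → ℤ) :
    exponentDegree W a = (∑ v ∈ Wᶜ, a v, ∑ v ∈ W, a v) := by
  rw [exponentDegree, ← Finset.sum_compl_add_sum W]
  have h1 : ∑ v ∈ Wᶜ, a v • bidegree W v = (∑ v ∈ Wᶜ, a v, 0) := by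
    rw [Finset.sum_congr rfl fun v hv => by
      rw [bidegree, if_neg (Finset.mem_compl.1 hv), Prod.smul_mk, smul_zero, smul_eq_mul, mul_one]]
    exact Prod.ext (by simp [Prod.fst_sum]) (by simp [Prod.snd_sum])
  have h2 : ∑ v ∈ W, a v • bidegree W v = (0, ∑ v ∈ W, a v) := by
    rw [Finset.sum_congr rfl fun v hv => by
      rw [bidegree, if_pos hv, Prod.smul_mk, smul_zero, smul_eq_mul, mul_one]]
    exact Prod.ext (by simp [Prod.fst_sum]) (by simp [Prod.snd_sum])
  rw [h1, h2, Prod.mk_add_mk, add_zero, zero_add]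

theorem exponentDegree_sub_indicator (c a : σ → ℤ) (U : Finset W) (l : ℕ)
    (h : ∀ v, a v = c v - if v ∈ vertices U then (l : ℤ) else 0) :
    exponentDegree W a = exponentDegree W c - l • ∑ w ∈ U, bidegree W (w : σ) := by
  have h1 : ∑ w ∈ U, bidegree W (w : σ) = ∑ v ∈ vertices U, bidegree W v := by
    rw [vertices, Finset.sum_map]
    rfl
  have h2 : ∑ v ∈ vertices U, l • bidegree W v =
      ∑ v, (if v ∈ vertices U then (l : ℤ) else 0) • bidegree W v := by
    simp [ite_smul]
  rw [h1, exponentDegree, exponentDegree, Finset.smul_sum, h2, eq_sub_iff_add_eq,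
    ← Finset.sum_add_distrib]
  refine Finset.sum_congr rfl fun v _ => ?_
  rw [← add_smul, h v, sub_add_cancel]

theorem weight_bidegree (c : σ →₀ ℕ) :
    Finsupp.weight (bidegree W) c = exponentDegree W (fun v => (c v : ℤ)) := by
  rw [Finsupp.weight_apply, exponentDegree, Finsupp.sum_fintype _ _ (by simp)]
  simp

/-- An element of `R_{y_U}` has bidegree `d` if all its Laurent monomials do. -/
theorem mem_cechTermComponent_iff {d : ℤ × ℤ} {U : Finset W} {z : CechTerm (yVar K Δ W) U} :
    z ∈ cechTermComponent K Δ W d U ↔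
      ∀ a, coefficient K Δ W U a z ≠ 0 → exponentDegree W a = d := by
  classical
  constructor
  · intro hz a
    refine Submodule.span_induction (p := fun z _ => coefficient K Δ W U a z ≠ 0 →
      exponentDegree W a = d) ?_ ?_ ?_ ?_ hz
    · rintro _ ⟨l, _, ⟨p, hp, rfl⟩, rfl⟩ hne
      have hfr := fraction_apply K Δ W U l p
      rw [AlgHom.toLinearMap_apply, Ideal.Quotient.mkₐ_eq_mk, ← hfr, p.as_sum, map_sum,
        map_sum] at hne
      obtain ⟨c, -, hc⟩ := Finset.exists_ne_zero_of_sum_ne_zero hne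
      rw [← mul_one (MvPolynomial.coeff c p), ← smul_eq_mul, ← MvPolynomial.smul_monomial, map_smul,
        map_smul, coefficient_fraction_monomial] at hc
      have hdeg := hp (left_ne_zero_of_mul hc)
      have hac : IsExponent Δ (vertices U) a ∧
          ∀ v, a v = c v - if v ∈ vertices U then (l : ℤ) else 0 := by
        by_contra h
        exact right_ne_zero_of_mul hc (if_neg h)
      rw [exponentDegree_sub_indicator (fun v => (c v : ℤ)) a U l hac.2, ← weight_bidegree, hdeg,
        add_sub_cancel_right]
    · intro h
      exact absurd (map_zero _) h
    · intro x y _ _ hx hy h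
      by_cases hx0 : coefficient K Δ W U a x = 0
      · refine hy fun h0 => h ?_
        rw [map_add, hx0, h0, add_zero]
      · exact hx hx0
    · intro r x _ hx h
      refine hx fun h0 => h ?_
      rw [map_smul, h0, smul_zero]
  · intro h
    obtain ⟨p, rfl, hp⟩ := exists_eq_linearCombination z
    rw [Finsupp.linearCombination_apply]
    refine Submodule.sum_mem _ fun a ha => Submodule.smul_mem _ _ ?_
    rw [laurentMonomial]
    split_ifs with hexp
    swap
    · exact Submodule.zero_mem _
    have hd := h a (by rw [hp]; exact Finsupp.mem_support_iff.1 ha)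
    refine Submodule.subset_span ⟨clearingPower a, _, ⟨_, ?_, rfl⟩, fraction_apply _ _ _ _ _ _⟩
    refine MvPolynomial.isWeightedHomogeneous_monomial _ _ _ ?_
    rw [weight_bidegree, ← sub_eq_iff_eq_add, ← exponentDegree_sub_indicator _ a U _ fun v => ?_]
    · exact hd
    · rw [numeratorExponent_apply hexp.1]; ring

end Grading

/-! ### The Čech complex, one exponent at a time -/

section Total

variable (K : Type*) [Field K] {σ : Type*} [Fintype σ] [LinearOrder σ] (Δ : LowerSet (Finset σ))
  (W : Finset σ)

/-- The sets `S ⊆ W` for which the Laurent monomial with exponent `a` is nonzero in the term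
of the Čech complex indexed by `S`. -/
def exponentSets (a : σ → ℤ) : Set (Finset σ) := {S | S ⊆ W ∧ IsExponent Δ S a}

/-- The coefficients of the Laurent monomial with exponent `a` in the entries of a Čech cochain, as
a function of the index `S ⊆ W`. -/
noncomputable def cechCoefficient (a : σ → ℤ) : CechTotal (yVar K Δ W) →ₗ[K] (Finset σ → K) :=
  LinearMap.pi fun S => if S ⊆ W then
    (coefficient K Δ W (S.subtype (· ∈ W)) a).comp (LinearMap.proj (S.subtype (· ∈ W))) else 0

omit [Fintype σ] [LinearOrder σ] in
theorem vertices_subset {W : Finset σ} (U : Finset W) : vertices U ⊆ W := by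
  intro v hv
  obtain ⟨w, -, rfl⟩ := Finset.mem_map.1 hv
  exact w.2

omit [Fintype σ] in
theorem exists_vertices_eq {W S : Finset σ} (h : S ⊆ W) : ∃ U : Finset W, S = vertices U :=
  ⟨S.subtype (· ∈ W), (Finset.subtype_map_of_mem fun _ hv => h hv).symm⟩

omit [Fintype σ] in
theorem subtype_vertices {W : Finset σ} (U : Finset W) :
    (vertices U).subtype (· ∈ W) = U := by
  ext w
  simp [vertices]

variable {K Δ W}

theorem cechCoefficient_vertices (a : σ → ℤ) (z : CechTotal (yVar K Δ W)) (U : Finset W) :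
    cechCoefficient K Δ W a z (vertices U) = coefficient K Δ W U a (z U) := by
  rw [cechCoefficient, LinearMap.pi_apply, if_pos (vertices_subset U), subtype_vertices]
  rfl

theorem cechCoefficient_of_not_subset (a : σ → ℤ) (z : CechTotal (yVar K Δ W)) {S : Finset σ}
    (h : ¬ S ⊆ W) : cechCoefficient K Δ W a z S = 0 := by
  rw [cechCoefficient, LinearMap.pi_apply, if_neg h, LinearMap.zero_apply]

theorem mem_exponentSets_of_cechCoefficient_ne_zero {a : σ → ℤ} {z : CechTotal (yVar K Δ W)}
    {S : Finset σ} (h : cechCoefficient K Δ W a z S ≠ 0) : S ∈ exponentSets Δ W a := by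
  by_cases hS : S ⊆ W
  · refine ⟨hS, ?_⟩
    obtain ⟨U, rfl⟩ := exists_vertices_eq hS
    rw [cechCoefficient_vertices] at h
    by_contra h'
    exact h (coefficient_eq_zero K Δ W h' _)
  · exact absurd (cechCoefficient_of_not_subset a z hS) h

theorem eq_of_cechCoefficient_eq {z z' : CechTotal (yVar K Δ W)}
    (h : ∀ a S, S ∈ exponentSets Δ W a →
      cechCoefficient K Δ W a z S = cechCoefficient K Δ W a z' S) : z = z' := by
  funext U
  refine eq_of_coefficient_eq fun a => ?_
  rw [← cechCoefficient_vertices, ← cechCoefficient_vertices]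
  by_cases hS : vertices U ∈ exponentSets Δ W a
  · exact h a _ hS
  · rw [not_not.1 (mt mem_exponentSets_of_cechCoefficient_ne_zero hS),
      not_not.1 (mt mem_exponentSets_of_cechCoefficient_ne_zero hS)]

theorem finite_cechCoefficient_ne_zero (z : CechTotal (yVar K Δ W)) :
    {a | cechCoefficient K Δ W a z ≠ 0}.Finite := by
  refine (Set.finite_iUnion fun U => finite_coefficient_ne_zero K Δ W (z U)).subset ?_
  intro a ha
  obtain ⟨S, hS⟩ := Function.ne_iff.1 ha
  obtain ⟨U, rfl⟩ := exists_vertices_eq (mem_exponentSets_of_cechCoefficient_ne_zero hS).1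
  rw [cechCoefficient_vertices] at hS
  exact Set.mem_iUnion.2 ⟨U, hS⟩

/-- On each Laurent monomial, the Čech differential is the simplicial coboundary. -/
theorem cechCoefficient_cechDifferential {a : σ → ℤ} (z : CechTotal (yVar K Δ W)) {S : Finset σ}
    (hS : S ∈ exponentSets Δ W a) :
    cechCoefficient K Δ W a (cechDifferential (yVar K Δ W) z) S =
      coboundary K (cechCoefficient K Δ W a z) S := by
  obtain ⟨hSW, hexp⟩ := hS
  obtain ⟨U, rfl⟩ := exists_vertices_eq hSW
  rw [cechCoefficient_vertices, cechDifferential, LinearMap.pi_apply, LinearMap.sum_apply, map_sum,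
    coboundary_apply]
  conv_rhs => rw [vertices, Finset.sum_map]
  refine Finset.sum_congr rfl fun w hw => ?_
  rw [LinearMap.smul_apply, neg_one_pow_ring_smul (K := K), map_smul, LinearMap.comp_apply,
    AlgHom.toLinearMap_apply, coefficient_cechRestriction, if_pos hexp, smul_eq_mul,
    LinearMap.proj_apply]
  have h1 : (U.map (Function.Embedding.subtype _)).erase (Function.Embedding.subtype _ w) =
      vertices (U.erase w) := (Finset.map_erase _ _ _).symm
  rw [h1, cechCoefficient_vertices]
  congr 1
  rw [faceSign, Finset.filter_map, Finset.card_map]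
  rfl

theorem mem_cechCochains_iff {t : ℤ} {z : CechTotal (yVar K Δ W)} :
    z ∈ cechCochains (yVar K Δ W) t ↔
      ∀ a, IsCochain (exponentSets Δ W a) t (cechCoefficient K Δ W a z) := by
  have hcard : ∀ U : Finset W, (vertices U).card = U.card := fun U => Finset.card_map _
  constructor
  · intro hz a S hS
    have hmem := mem_exponentSets_of_cechCoefficient_ne_zero hS
    refine ⟨hmem, ?_⟩
    obtain ⟨U, rfl⟩ := exists_vertices_eq hmem.1
    rw [hcard]
    by_contra hU
    rw [cechCoefficient_vertices, hz U hU, map_zero] at hS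
    exact hS rfl
  · intro h U hU
    refine eq_of_coefficient_eq fun a => ?_
    rw [map_zero, ← cechCoefficient_vertices]
    by_contra h'
    exact hU (hcard U ▸ (h a _ h').2)

theorem mem_cechCocycles_iff {t : ℤ} {z : CechTotal (yVar K Δ W)} :
    z ∈ cechCocycles (yVar K Δ W) t ↔
      ∀ a, IsCochain (exponentSets Δ W a) t (cechCoefficient K Δ W a z) ∧
        ∀ S ∈ exponentSets Δ W a, coboundary K (cechCoefficient K Δ W a z) S = 0 := by
  rw [cechCocycles, Submodule.mem_inf, mem_cechCochains_iff, forall_and, LinearMap.mem_ker]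
  refine and_congr_right fun _ => ⟨fun h a S hS => ?_, fun h => ?_⟩
  · rw [← cechCoefficient_cechDifferential z hS, h, map_zero, Pi.zero_apply]
  · refine eq_of_cechCoefficient_eq fun a S hS => ?_
    rw [cechCoefficient_cechDifferential z hS, h a S hS, map_zero, Pi.zero_apply]

/-- A finite family of cochains, one for each exponent, consists of the coefficients of a
Čech cochain. -/
theorem exists_cechCoefficient_eq (s : Finset (σ → ℤ)) (c : (σ → ℤ) → Finset σ → K) {t : ℤ}
    (hc : ∀ a, IsCochain (exponentSets Δ W a) t (c a)) (hs : ∀ a ∉ s, c a = 0) :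
    ∃ z : CechTotal (yVar K Δ W), ∀ a, cechCoefficient K Δ W a z = c a := by
  classical
  refine ⟨fun U => ∑ a ∈ s, c a (vertices U) • laurentMonomial K Δ W U a, fun a => ?_⟩
  funext S
  by_cases hS : S ⊆ W
  swap
  · rw [cechCoefficient_of_not_subset a _ hS]
    by_contra h
    exact hS ((hc a S (Ne.symm h)).1.1)
  obtain ⟨U, rfl⟩ := exists_vertices_eq hS
  rw [cechCoefficient_vertices, map_sum]
  simp only [map_smul, coefficient_laurentMonomial, smul_eq_mul]
  rw [Finset.sum_eq_single a]
  · by_cases h : c a (vertices U) = 0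
    · rw [h, zero_mul]
    · rw [if_pos ⟨(hc a _ h).1.2, rfl⟩, mul_one]
  · intro b _ hb
    rw [if_neg fun h => hb h.2.symm, mul_zero]
  · intro ha
    rw [hs a ha, Pi.zero_apply, zero_mul]

theorem mem_cechCoboundaries_iff {t : ℤ} {z : CechTotal (yVar K Δ W)} :
    z ∈ cechCoboundaries (yVar K Δ W) t ↔
      ∀ a, ∃ b, IsCochain (exponentSets Δ W a) (t - 1) b ∧
        ∀ S ∈ exponentSets Δ W a, coboundary K b S = cechCoefficient K Δ W a z S := by
  classical
  constructor
  · rintro ⟨b, hb, rfl⟩ a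
    exact ⟨_, mem_cechCochains_iff.1 hb a, fun S hS => (cechCoefficient_cechDifferential b hS).symm⟩
  · intro h
    choose b hb hbz using h
    -- Only finitely many exponents occur in `z`; the others are given the zero cochain.
    have hfin := finite_cechCoefficient_ne_zero z
    obtain ⟨y, hy⟩ := exists_cechCoefficient_eq (K := K) (Δ := Δ) (W := W) (t := t - 1)
      hfin.toFinset
      (fun a => if cechCoefficient K Δ W a z = 0 then 0 else b a) (fun a => by
        split_ifs
        · exact fun S hS => absurd rfl hS
        · exact hb a) (fun a ha => by
        rw [Set.Finite.mem_toFinset, Set.mem_ofPred_eq, not_not] at ha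
        exact if_pos ha)
    refine ⟨y, mem_cechCochains_iff.2 fun a => ?_, eq_of_cechCoefficient_eq fun a S hS => ?_⟩
    · rw [hy]
      split_ifs
      · exact fun S hS => absurd rfl hS
      · exact hb a
    · rw [cechCoefficient_cechDifferential y hS, hy]
      split_ifs with h0
      · rw [h0, map_zero]
      · exact hbz a S hS

theorem mem_pi_cechTermComponent_iff {d : ℤ × ℤ} {z : CechTotal (yVar K Δ W)} :
    z ∈ Submodule.pi Set.univ (cechTermComponent K Δ W d) ↔
      ∀ a, cechCoefficient K Δ W a z ≠ 0 → exponentDegree W a = d := by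
  rw [Submodule.mem_pi]
  constructor
  · intro h a ha
    obtain ⟨S, hS⟩ := Function.ne_iff.1 ha
    obtain ⟨U, rfl⟩ := exists_vertices_eq (mem_exponentSets_of_cechCoefficient_ne_zero hS).1
    rw [cechCoefficient_vertices] at hS
    exact mem_cechTermComponent_iff.1 (h U trivial) a hS
  · intro h U _
    refine mem_cechTermComponent_iff.2 fun a ha => h a fun h0 => ha ?_
    rw [← cechCoefficient_vertices, h0, Pi.zero_apply]

end Total

/-! ### The exponents contributing to a bidegree -/

section Exponents

variable {σ : Type*} [Fintype σ] [LinearOrder σ] {Δ : LowerSet (Finset σ)} {W : Finset σ}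

/-- The set of indices at which `a` is negative. -/
def negativeSet (a : σ → ℤ) : Finset σ := Finset.univ.filter fun v => a v < 0

/-- The set of indices at which `a` is positive. -/
def positiveSet (a : σ → ℤ) : Finset σ := Finset.univ.filter fun v => 0 < a v

omit [LinearOrder σ] in
theorem mem_negativeSet {a : σ → ℤ} {v : σ} : v ∈ negativeSet a ↔ a v < 0 := by
  simp [negativeSet]

omit [LinearOrder σ] in
theorem mem_positiveSet {a : σ → ℤ} {v : σ} : v ∈ positiveSet a ↔ 0 < a v := by
  simp [positiveSet]

variable (W) in
open scoped Classical in
/-- The exponents of bidegree `(k, j)` which are nonpositive on `W` and nonnegative off `W`. Only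
these contribute to local cohomology. -/
noncomputable def essentialExponents (k j : ℤ) : Finset (σ → ℤ) :=
  (Finset.Icc (fun _ => min j 0) (fun _ => max k 0)).filter
    (fun a => exponentDegree W a = (k, j) ∧ (∀ v ∈ W, a v ≤ 0) ∧ ∀ v ∉ W, 0 ≤ a v)

theorem mem_essentialExponents {k j : ℤ} {a : σ → ℤ} :
    a ∈ essentialExponents W k j ↔
      exponentDegree W a = (k, j) ∧ (∀ v ∈ W, a v ≤ 0) ∧ ∀ v ∉ W, 0 ≤ a v := by
  rw [essentialExponents, Finset.mem_filter, and_iff_right_iff_imp, Finset.mem_Icc]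
  rintro ⟨h1, h2, h3⟩
  rw [exponentDegree_eq, Prod.mk.injEq] at h1
  have hV : ∀ v ∉ W, a v ≤ k := fun v hv => h1.1 ▸ Finset.single_le_sum
    (fun u hu => h3 u (Finset.mem_compl.1 hu)) (Finset.mem_compl.2 hv)
  have hW : ∀ v ∈ W, j ≤ a v := fun v hv => by
    rw [← h1.2, ← Finset.add_sum_erase W a hv, add_le_iff_nonpos_right]
    exact Finset.sum_nonpos fun u hu => h2 u (Finset.mem_of_mem_erase hu)
  refine ⟨fun v => ?_, fun v => ?_⟩
  · by_cases hv : v ∈ W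
    · exact (min_le_left _ _).trans (hW v hv)
    · exact (min_le_right _ _).trans (h3 v hv)
  · by_cases hv : v ∈ W
    · exact (h2 v hv).trans (le_max_right _ _)
    · exact (hV v hv).trans (le_max_left _ _)

theorem negativeSet_subset {k j : ℤ} {a : σ → ℤ} (ha : a ∈ essentialExponents W k j) :
    negativeSet a ⊆ W := by
  intro v hv
  by_contra h
  exact absurd ((mem_essentialExponents.1 ha).2.2 v h) (mem_negativeSet.1 hv).not_ge

theorem disjoint_positiveSet {k j : ℤ} {a : σ → ℤ} (ha : a ∈ essentialExponents W k j) :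
    Disjoint (positiveSet a) W :=
  Finset.disjoint_left.2 fun v hv hvW =>
    absurd ((mem_essentialExponents.1 ha).2.1 v hvW) (mem_positiveSet.1 hv).not_ge

/-- The subsets of `W` at which the exponent `a` occurs are determined by the signs of `a`. -/
theorem exponentSets_eq_starSets (Δ : LowerSet (Finset σ)) (W : Finset σ) (a : σ → ℤ) :
    exponentSets Δ W a = starSets Δ W (negativeSet a) (positiveSet a) := by
  ext S
  have h1 : (∀ v ∉ S, 0 ≤ a v) ↔ negativeSet a ⊆ S := by
    refine forall_congr' fun v => ?_
    rw [mem_negativeSet]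
    constructor
    · exact fun h hv => by_contra fun hS => hv.not_ge (h hS)
    · exact fun h hS => not_lt.1 fun hv => hS (h hv)
  have h2 : negativeSet a ⊆ S → S ∪ degreeSupport a = S ∪ positiveSet a := by
    intro h
    ext v
    rw [Finset.mem_union, Finset.mem_union, mem_degreeSupport, mem_positiveSet]
    constructor
    · rintro (hv | hv)
      · exact Or.inl hv
      · rcases lt_or_gt_of_ne hv with hv | hv
        · exact Or.inl (h (mem_negativeSet.2 hv))
        · exact Or.inr hv
    · exact Or.imp_right fun hv => hv.ne'
  change (S ⊆ W ∧ (∀ v ∉ S, 0 ≤ a v) ∧ S ∪ degreeSupport a ∈ Δ) ↔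
    (negativeSet a ⊆ S ∧ S ⊆ W ∧ S ∪ positiveSet a ∈ Δ)
  rw [h1]
  constructor
  · rintro ⟨h3, h4, h5⟩
    exact ⟨h4, h3, h2 h4 ▸ h5⟩
  · rintro ⟨h4, h3, h5⟩
    exact ⟨h3, h4, (h2 h4).symm ▸ h5⟩

theorem exponentSets_eq_empty {a : σ → ℤ} {v : σ} (hv : v ∉ W) (ha : a v < 0) :
    exponentSets Δ W a = ∅ := by
  refine Set.eq_empty_of_forall_notMem fun S hS => ?_
  exact absurd (hS.2.1 v fun h => hv (hS.1 h)) ha.not_ge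

/-- If `a` is positive at some `w ∈ W`, then its index sets form a cone with apex `w`. -/
theorem insert_mem_exponentSets_iff {a : σ → ℤ} {w : σ} (hw : w ∈ W) (ha : 0 < a w)
    (S : Finset σ) : insert w S ∈ exponentSets Δ W a ↔ S ∈ exponentSets Δ W a := by
  have h1 : insert w S ∪ degreeSupport a = S ∪ degreeSupport a := by
    rw [Finset.insert_union, Finset.insert_eq_of_mem]
    exact Finset.mem_union_right _ (mem_degreeSupport.2 ha.ne')
  change (insert w S ⊆ W ∧ (∀ v ∉ insert w S, 0 ≤ a v) ∧ insert w S ∪ degreeSupport a ∈ Δ) ↔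
    (S ⊆ W ∧ (∀ v ∉ S, 0 ≤ a v) ∧ S ∪ degreeSupport a ∈ Δ)
  rw [h1, Finset.insert_subset_iff, and_iff_right hw]
  refine and_congr_right fun _ => and_congr_left fun _ => ⟨fun h v hv => ?_, fun h v hv => ?_⟩
  · rcases eq_or_ne v w with rfl | hvw
    · exact ha.le
    · exact h v (by simp [hvw, hv])
  · exact h v fun h' => hv (Finset.mem_insert_of_mem h')

theorem card_filter_essentialExponents {F G : Finset σ} (hF : F ⊆ W) (hG : G ⊆ Wᶜ) (k j : ℤ) :
    ((essentialExponents W k j).filter fun a => (negativeSet a, positiveSet a) = (F, G)).card =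
      binom (k - 1) ((G.card : ℤ) - 1) * binom (-j - 1) ((F.card : ℤ) - 1) := by
  have hGW : ∀ v ∈ G, v ∉ W := fun v hv => Finset.mem_compl.1 (hG hv)
  have hFG : Disjoint F G := Finset.disjoint_left.2 fun v hv hv' => hGW v hv' (hF hv)
  refine card_eq_binom_mul_binom hFG k j fun a => ?_
  rw [Finset.mem_filter, mem_essentialExponents, Prod.mk.injEq, exponentDegree_eq, Prod.mk.injEq]
  have hsum : (∀ v, v ∉ F → v ∉ G → a v = 0) →
      ∑ v ∈ Wᶜ, a v = ∑ v ∈ G, a v ∧ ∑ v ∈ W, a v = ∑ v ∈ F, a v := fun h0 =>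
    ⟨(Finset.sum_subset hG fun v hv hvG => h0 v (fun h => Finset.mem_compl.1 hv (hF h)) hvG).symm,
      (Finset.sum_subset hF fun v hv hvF => h0 v hvF fun h => hGW v h hv).symm⟩
  constructor
  · rintro ⟨⟨⟨hk, hj⟩, -, -⟩, rfl, rfl⟩
    have h0 : ∀ v, v ∉ negativeSet a → v ∉ positiveSet a → a v = 0 := fun v h1 h2 => by
      rw [mem_negativeSet] at h1
      rw [mem_positiveSet] at h2
      omega
    rw [(hsum h0).1] at hk
    rw [(hsum h0).2] at hj
    refine ⟨fun v hv => mem_positiveSet.1 hv, fun v hv => ?_, h0, hk, hj⟩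
    have := mem_negativeSet.1 hv
    omega
  · rintro ⟨h1, h2, h0, hk, hj⟩
    rw [(hsum h0).1, (hsum h0).2]
    have hF' : negativeSet a = F := by
      ext v
      rw [mem_negativeSet]
      refine ⟨fun h => ?_, fun h => by have := h2 v h; omega⟩
      by_contra hv
      by_cases hvG : v ∈ G
      · have := h1 v hvG; omega
      · have := h0 v hv hvG; omega
    have hG' : positiveSet a = G := by
      ext v
      rw [mem_positiveSet]
      refine ⟨fun h => ?_, fun h => by have := h1 v h; omega⟩
      by_contra hv
      by_cases hvF : v ∈ F
      · have := h2 v hvF; omega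
      · have := h0 v hvF hv; omega
    refine ⟨⟨⟨hk, hj⟩, fun v hv => ?_, fun v hv => ?_⟩, hF', hG'⟩
    · by_contra h
      rw [not_le, ← mem_positiveSet, hG'] at h
      exact hGW v h hv
    · by_contra h
      rw [not_le, ← mem_negativeSet, hF'] at h
      exact hv (hF h)

end Exponents

/-! ### Passage to dimensions -/

section LinearAlgebra

/-- Two linear maps with the same kernel on a subspace have isomorphic images of it. -/
theorem nonempty_map_linearEquiv_map {K V Q P : Type*} [Field K] [AddCommGroup V] [Module K V]
    [AddCommGroup Q] [Module K Q] [AddCommGroup P] [Module K P] (p : Submodule K V)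
    (f : V →ₗ[K] Q) (g : V →ₗ[K] P) (h : ∀ x ∈ p, f x = 0 ↔ g x = 0) :
    Nonempty (p.map f ≃ₗ[K] p.map g) := by
  have hk : LinearMap.ker (f.domRestrict p) = LinearMap.ker (g.domRestrict p) := by
    ext x
    exact h x.1 x.2
  have hf : LinearMap.range (f.domRestrict p) = p.map f := by
    rw [LinearMap.domRestrict, LinearMap.range_comp, Submodule.range_subtype]
  have hg : LinearMap.range (g.domRestrict p) = p.map g := by
    rw [LinearMap.domRestrict, LinearMap.range_comp, Submodule.range_subtype]
  exact ⟨(LinearEquiv.ofEq _ _ hf).symm ≪≫ₗ (f.domRestrict p).quotKerEquivRange.symm ≪≫ₗ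
    Submodule.quotEquivOfEq _ _ hk ≪≫ₗ (g.domRestrict p).quotKerEquivRange ≪≫ₗ
    LinearEquiv.ofEq _ _ hg⟩

/-- A family of functionals on the `M a` that vanish on the `B a` is a family of functionals on the
quotients `M a ⧸ B a`, which gives the dimension of the space `R` of such families. -/
theorem finite_and_finrank_eq_sum_of_mem_iff {K ι : Type*} [Field K] [Fintype ι] {M : ι → Type*}
    [∀ a, AddCommGroup (M a)] [∀ a, Module K (M a)] [∀ a, Module.Finite K (M a)]
    (B : ∀ a, Submodule K (M a)) (R : Submodule K (∀ a, Module.Dual K (M a)))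
    (hR : ∀ g, g ∈ R ↔ ∀ a, ∀ x ∈ B a, g a x = 0) :
    Module.Finite K R ∧ Module.finrank K R = ∑ a, Module.finrank K (M a ⧸ B a) := by
  refine ⟨inferInstance, ?_⟩
  let D : (∀ a, Module.Dual K (M a ⧸ B a)) →ₗ[K] ∀ a, Module.Dual K (M a) :=
    LinearMap.pi fun a => (B a).mkQ.dualMap.comp (LinearMap.proj a)
  have hD : LinearMap.range D = R := by
    ext g
    rw [hR]
    constructor
    · rintro ⟨f, rfl⟩ a x hx
      change f a ((B a).mkQ x) = 0
      rw [Submodule.mkQ_apply, (Submodule.Quotient.mk_eq_zero _).2 hx, map_zero]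
    · intro h
      refine ⟨fun a => (B a).liftQ (g a) (h a), funext fun a => ?_⟩
      exact (B a).liftQ_mkQ (g a) (h a)
  have hinj : Function.Injective D := by
    refine (injective_iff_map_eq_zero D).2 fun f hf => funext fun a => ?_
    refine LinearMap.ext fun x => ?_
    obtain ⟨x, rfl⟩ := (B a).mkQ_surjective x
    exact LinearMap.congr_fun (congrFun hf a) x
  rw [← hD, LinearMap.finrank_range_of_inj hinj, Module.finrank_pi_fintype]
  exact Finset.sum_congr rfl fun a _ => Subspace.dual_finrank_eq

end LinearAlgebra

section LocalCohomology

variable {K : Type*} [Field K] {σ : Type*} [Fintype σ] [LinearOrder σ] {Δ : LowerSet (Finset σ)}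
  {W : Finset σ}

variable (K Δ W) in
/-- The reduced cycles of `(lk (F ∪ G))_W` in degree `i - |F| - 1`, where `F` and `G` are the sets
at which `a` is negative and positive. -/
noncomputable abbrev linkCycles (i : ℤ) (a : σ → ℤ) : Submodule K (Finset σ →₀ K) :=
  cycles K (restrict (link Δ (negativeSet a ∪ positiveSet a)) W) (i - (negativeSet a).card - 1)

variable (K Δ W) in
/-- The reduced boundaries of `(lk (F ∪ G))_W` in degree `i - |F| - 1`, where `F` and `G` are the
sets at which `a` is negative and positive. -/
noncomputable abbrev linkBoundaries (i : ℤ) (a : σ → ℤ) : Submodule K (Finset σ →₀ K) :=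
  boundaries K (restrict (link Δ (negativeSet a ∪ positiveSet a)) W) (i - (negativeSet a).card - 1)

variable (K Δ W) in
/-- The pairings of the coefficients of a Čech cochain at the essential exponents with the cycles
of the corresponding links. -/
noncomputable def cechPairing (i k j : ℤ) : CechTotal (yVar K Δ W) →ₗ[K]
    ∀ a : essentialExponents W k j, Module.Dual K (linkCycles K Δ W i a) :=
  LinearMap.pi fun a => ((linkCycles K Δ W i a).subtype.dualMap.comp
    (joinPairing K (negativeSet a.1))).comp (cechCoefficient K Δ W a)

theorem cechPairing_apply (i k j : ℤ) (z : CechTotal (yVar K Δ W))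
    (a : essentialExponents W k j) (x : linkCycles K Δ W i a) :
    cechPairing K Δ W i k j z a x =
      joinPairing K (negativeSet a.1) (cechCoefficient K Δ W a z) x.1 := rfl

/-- A bihomogeneous Čech cocycle is a coboundary if and only if its pairings with the cycles of the
links vanish. -/
theorem mem_cechCoboundaries_iff_cechPairing_eq_zero {i k j : ℤ} {z : CechTotal (yVar K Δ W)}
    (hz : z ∈ cechCocycles (yVar K Δ W) i)
    (hd : z ∈ Submodule.pi Set.univ (cechTermComponent K Δ W (k, j))) :
    z ∈ cechCoboundaries (yVar K Δ W) i ↔ cechPairing K Δ W i k j z = 0 := by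
  rw [mem_cechCocycles_iff] at hz
  rw [mem_pi_cechTermComponent_iff] at hd
  rw [mem_cechCoboundaries_iff]
  constructor
  · intro h
    funext a
    ext x
    obtain ⟨b, hb, hbz⟩ := h a
    rw [exponentSets_eq_starSets] at hb hbz
    exact joinPairing_eq_zero_of_mem_cycles (negativeSet_subset a.2) hb hbz x.2
  · intro h a
    by_cases h0 : cechCoefficient K Δ W a z = 0
    · refine ⟨0, fun S hS => absurd rfl hS, fun S _ => ?_⟩
      rw [h0, map_zero]
    by_cases hW : ∀ v ∈ W, a v ≤ 0
    · by_cases hV : ∀ v ∉ W, 0 ≤ a v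
      · have ha : a ∈ essentialExponents W k j := mem_essentialExponents.2 ⟨hd a h0, hW, hV⟩
        rw [exponentSets_eq_starSets]
        refine exists_coboundary_of_joinPairing_eq_zero (t := i) (negativeSet_subset ha)
          (disjoint_positiveSet ha) ?_ fun x hx => ?_
        · rw [← exponentSets_eq_starSets]
          exact (hz a).1
        · exact LinearMap.congr_fun (congrFun h ⟨a, ha⟩) ⟨x, hx⟩
      · push Not at hV
        obtain ⟨v, hv, hav⟩ := hV
        rw [exponentSets_eq_empty hv hav]
        exact ⟨0, fun S hS => absurd rfl hS, fun S hS => hS.elim⟩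
    · push Not at hW
      obtain ⟨w, hw, haw⟩ := hW
      exact (hz a).1.exists_coboundary_of_cone (insert_mem_exponentSets_iff hw haw) (hz a).2

/-- The families of functionals obtained from bihomogeneous Čech cocycles are those that vanish on
the boundaries. -/
theorem exists_cechPairing_eq_iff {i k j : ℤ}
    (g : ∀ a : essentialExponents W k j, Module.Dual K (linkCycles K Δ W i a)) :
    (∃ z ∈ cechCocycles (yVar K Δ W) i,
      z ∈ Submodule.pi Set.univ (cechTermComponent K Δ W (k, j)) ∧ cechPairing K Δ W i k j z = g) ↔
      ∀ a : essentialExponents W k j,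
        ∀ x ∈ (linkBoundaries K Δ W i a).submoduleOf (linkCycles K Δ W i a), g a x = 0 := by
  classical
  constructor
  · rintro ⟨z, hz, -, rfl⟩ a x hx
    rw [mem_cechCocycles_iff] at hz
    have := hz a
    rw [exponentSets_eq_starSets] at this
    exact joinPairing_eq_zero_of_mem_boundaries (negativeSet_subset a.2) this.1 this.2 hx
  · intro h
    have hex := fun a : essentialExponents W k j => exists_cocycle_joinPairing_eq (Δ := Δ)
      (negativeSet_subset a.2) (disjoint_positiveSet a.2) i (g a) (fun x hx => h a x hx)
    choose c hc hz hg using hex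
    let c' : (σ → ℤ) → Finset σ → K :=
      fun a => if ha : a ∈ essentialExponents W k j then c ⟨a, ha⟩ else 0
    have hc' : ∀ a, IsCochain (exponentSets Δ W a) i (c' a) ∧
        ∀ S ∈ exponentSets Δ W a, coboundary K (c' a) S = 0 := fun a => by
      by_cases ha : a ∈ essentialExponents W k j
      · simp only [c', dif_pos ha]
        rw [exponentSets_eq_starSets]
        exact ⟨hc ⟨a, ha⟩, hz ⟨a, ha⟩⟩
      · simp only [c', dif_neg ha]
        exact ⟨fun S hS => absurd rfl hS, fun S _ => by rw [map_zero, Pi.zero_apply]⟩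
    obtain ⟨z, hzc⟩ := exists_cechCoefficient_eq (K := K) (Δ := Δ) (W := W)
      (essentialExponents W k j) c' (fun a => (hc' a).1) fun a ha => dif_neg ha
    refine ⟨z, mem_cechCocycles_iff.2 fun a => ?_,
      mem_pi_cechTermComponent_iff.2 fun a ha => ?_, ?_⟩
    · rw [hzc]
      exact hc' a
    · rw [hzc] at ha
      have hmem : a ∈ essentialExponents W k j := by
        by_contra h'
        exact ha (dif_neg h')
      exact (mem_essentialExponents.1 hmem).1
    · funext a
      ext x
      rw [cechPairing_apply, hzc]
      simp only [c', dif_pos a.2]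
      exact hg a x

variable (K Δ W) in
/-- A bigraded component of local cohomology is isomorphic to the image of the pairing map. -/
theorem nonempty_localCohomologyComponent_linearEquiv (i k j : ℤ) :
    Nonempty (localCohomologyComponent K Δ W i (k, j) ≃ₗ[K]
      (Submodule.comap ((cechCocycles (yVar K Δ W) i).subtype.restrictScalars K)
        (Submodule.pi Set.univ (cechTermComponent K Δ W (k, j)))).map
        ((cechPairing K Δ W i k j).comp
          ((cechCocycles (yVar K Δ W) i).subtype.restrictScalars K))) := by
  refine nonempty_map_linearEquiv_map _ _ _ fun x hx => ?_
  rw [LinearMap.restrictScalars_apply, Submodule.mkQ_apply, Submodule.Quotient.mk_eq_zero]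
  exact mem_cechCoboundaries_iff_cechPairing_eq_zero x.2 hx

theorem finrank_localCohomologyComponent (i k j : ℤ) :
    Module.Finite K (localCohomologyComponent K Δ W i (k, j)) ∧
    Module.finrank K (localCohomologyComponent K Δ W i (k, j)) =
      ∑ a ∈ essentialExponents W k j, linkDim K Δ W i (negativeSet a) (positiveSet a) := by
  obtain ⟨e⟩ := nonempty_localCohomologyComponent_linearEquiv K Δ W i k j
  have h := finite_and_finrank_eq_sum_of_mem_iff (K := K)
    (M := fun a : essentialExponents W k j => linkCycles K Δ W i a)
    (fun a => (linkBoundaries K Δ W i a).submoduleOf (linkCycles K Δ W i a))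
    ((Submodule.comap ((cechCocycles (yVar K Δ W) i).subtype.restrictScalars K)
        (Submodule.pi Set.univ (cechTermComponent K Δ W (k, j)))).map
        ((cechPairing K Δ W i k j).comp
          ((cechCocycles (yVar K Δ W) i).subtype.restrictScalars K))) (fun g => by
    rw [← exists_cechPairing_eq_iff]
    constructor
    · rintro ⟨z, hz, rfl⟩
      exact ⟨z.1, z.2, hz, rfl⟩
    · rintro ⟨z, hz, hd, rfl⟩
      exact ⟨⟨z, hz⟩, hd, rfl⟩)
  have := h.1
  refine ⟨Module.Finite.equiv e.symm, ?_⟩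
  rw [e.finrank_eq, h.2]
  exact Finset.sum_coe_sort (essentialExponents W k j)
    (fun a => linkDim K Δ W i (negativeSet a) (positiveSet a))

omit [Fintype σ] in
theorem linkDim_eq_zero {F G : Finset σ} (hF : F ∉ Δ) (i : ℤ) : linkDim K Δ W i F G = 0 := by
  have h : ∀ q, cycles K (restrict (link Δ (F ∪ G)) W) q = ⊥ := fun q => by
    rw [cycles, chains, eq_bot_iff]
    refine inf_le_left.trans ?_
    have : {T | T ∈ restrict (link Δ (F ∪ G)) W ∧ (T.card : ℤ) = q + 1} = ∅ := by
      refine Set.eq_empty_of_forall_notMem fun T hT => hF ?_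
      exact Δ.lower (Finset.subset_union_left.trans Finset.subset_union_right)
        (mem_restrict_link.1 hT.1).1.1
    rw [this, Finsupp.supported_empty]
  have hs : ∀ q, Subsingleton (cycles K (restrict (link Δ (F ∪ G)) W) q) := fun q => by
    rw [h]
    infer_instance
  have := (Submodule.mkQ_surjective (R := K)
    (M := cycles K (restrict (link Δ (F ∪ G)) W) (i - F.card - 1))
    ((boundaries K (restrict (link Δ (F ∪ G)) W) (i - F.card - 1)).submoduleOf _)).subsingleton
  exact Module.finrank_zero_of_subsingleton

omit [LinearOrder σ] in
theorem mem_faces {Γ : LowerSet (Finset σ)} {T : Finset σ} : T ∈ faces Γ ↔ T ∈ Γ := by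
  simp [faces]

end LocalCohomology

end StanleyReisner

open StanleyReisner in
theorem mainTheorem7 {K : Type*} [Field K] {σ : Type*} [Fintype σ] [LinearOrder σ]
    (Δ : LowerSet (Finset σ)) (W : Finset σ) (i k j : ℤ) :
    Module.Finite K (StanleyReisner.localCohomologyComponent K Δ W i (k, j)) ∧
    Module.finrank K (StanleyReisner.localCohomologyComponent K Δ W i (k, j)) =
      ∑ F ∈ StanleyReisner.faces (StanleyReisner.restrict Δ W), ∑ G ∈ Wᶜ.powerset,
        StanleyReisner.linkDim K Δ W i F G *
          StanleyReisner.binom (k - 1) ((G.card : ℤ) - 1) *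
          StanleyReisner.binom (-j - 1) ((F.card : ℤ) - 1) := by
  obtain ⟨hfin, hrank⟩ := finrank_localCohomologyComponent (K := K) (Δ := Δ) (W := W) i k j
  refine ⟨hfin, hrank.trans ?_⟩
  have hmaps : ∀ a ∈ essentialExponents W k j,
      (negativeSet a, positiveSet a) ∈ W.powerset ×ˢ Wᶜ.powerset := fun a ha =>
    Finset.mem_product.2 ⟨Finset.mem_powerset.2 (negativeSet_subset ha), Finset.mem_powerset.2
      (Finset.subset_compl_iff_disjoint_right.2 (disjoint_positiveSet ha))⟩
  rw [← Finset.sum_fiberwise_of_maps_to' hmaps (fun p => linkDim K Δ W i p.1 p.2),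
    Finset.sum_product]
  symm
  have hfaces : faces (restrict Δ W) ⊆ W.powerset := fun F hF =>
    Finset.mem_powerset.2 (mem_faces.1 hF).2
  rw [Finset.sum_subset hfaces]
  · refine Finset.sum_congr rfl fun F hF => Finset.sum_congr rfl fun G hG => ?_
    rw [Finset.sum_const, card_filter_essentialExponents (Finset.mem_powerset.1 hF)
      (Finset.mem_powerset.1 hG), smul_eq_mul]
    ring
  · intro F hFW hF
    refine Finset.sum_eq_zero fun G _ => ?_
    rw [linkDim_eq_zero, zero_mul, zero_mul]
    exact fun h => hF (mem_faces.2 ⟨h, Finset.mem_powerset.1 hFW⟩)
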